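/- Let $X,Y$ be complex Hilbert spaces, let $A$ be an unbounded self-adjoint, strictly positive operator on $X$ with compact resolvent (strictly positive: $\langle Az,z\rangle\ge m\|z\|^2$ on $D(A)$ for some $m>0$), let $X_2=D(A)$ with the norm $\|Az\|_X$, and let $C:X_2\to Y$ be linear, bounded and admissible: for every $T>0$ there is $K_T>0$ with $\int_0^T\|Ce^{itA}z_0\|_Y^2\,dt\le K_T\|z_0\|_X^2$ for all $z_0\in X_2$. Consider the system $\dot z=iAz$, $z(0)=z_0$, $y=Cz$, so that $z(t)=e^{itA}z_0$. For $z\in X_2\setminus\{0\}$ put $\lambda(z)=\langle Az,z\rangle\|z\|^{-2}$. Let $\mathfrak C$ be the set of continuous, decreasing (i.e. non-increasing) functions $[0,\infty)\to(0,\infty)$. For $\varepsilon,\psi\in\mathfrak C$, the operator $C$ is called *spectrally coercive with* $\varepsilon,\psi$ if for all $z\in X_2\setminus\{0\}$ $$\frac{\|Az\|^2}{\|z\|^2}-\lambda(z)^2<\varepsilon(\lambda(z))\ \Longrightarrow\ \|Cz\|_Y^2\ge\psi(\lambda(z))\|z\|_X^2,$$ and *spectrally coercive* if this holds for some $\varepsilon,\psi\in\mathfrak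 C$. The system is *weakly observable in time* $T>0$ if there is $\psi\in\mathfrak C$ with $\psi(\lambda(z_0))\|z_0\|_X^2\le\int_0^T\|Ce^{itA}z_0\|_Y^2\,dt$ for all $z_0\in X_2\setminus\{0\}$. **Observation time.** For all $\theta_0,\theta_1>0$, $\varepsilon\in\mathfrak C$ and $\lambda\ge0$ the equation $$T\,\varepsilon\!\left(\theta_0\left(\tfrac1T+\lambda\right)\right)=\theta_1$$ has a unique solution $T=T(\lambda)>0$, and $\lambda\mapsto T(\lambda)$ is increasing (i.e. non-decreasing). **Theorem.** There is an absolute constant $\theta_0>0$ and, for every $E>0$, there are constants $\theta_1,\theta_2>0$ depending only on $E$, such that for all $X,Y,A,C$ as above: 1. The system is weakly observable in some time $T>0$ if and only if $C$ is spectrally coercive. 2. $C$ is spectrally coercive if and only if there are $\varepsilon,\psi\in\mathfrak C$ such that, with $T(\cdot)$ defined by $\theta_0,\theta_1,\varepsilon$, $$\theta_2\,\psi\!\left(\theta_0\left(\tfrac1T+\lambda(z_0)\right)\right)\|z_0\|_X^2\le\int_0^T\|Cz(t)\|_Y^2\,dt\qquad\text{for all } z_0\in X_2\setminus\{0\}\text{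 and all } T\ge T(\lambda(z_0)).\tag{$*$}$$ 3. If $C$ is spectrally coercive with $\varepsilon,\psi\in\mathfrak C$ and $\varepsilon(0)\le E$, then $(*)$ holds with these same $\varepsilon,\psi$. -/

import Mathlib

namespace WeakObservability

open scoped InnerProductSpace

/-- The class `𝔠` of continuous, decreasing (in the wide sense, so constants are allowed),
strictly positive functions on `ℝ₊ = [0, ∞)`. Values at negative reals are irrelevant. -/
structure IsDecreasingProfile (f : ℝ → ℝ) : Prop where
  continuousOn : ContinuousOn f (Set.Ici 0)
  antitoneOn : AntitoneOn f (Set.Ici 0)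
  pos : ∀ x, 0 ≤ x → 0 < f x

section System

variable {X : Type*} [NormedAddCommGroup X] [InnerProductSpace ℂ X]
variable {Y : Type*} [NormedAddCommGroup Y] [InnerProductSpace ℂ Y]

/-- Strict positivity of an unbounded operator: `⟨A z, z⟩ ≥ m ‖z‖²` for some `m > 0`. -/
def IsStrictlyPositive (A : X →ₗ.[ℂ] X) : Prop :=
  ∃ m : ℝ, 0 < m ∧ ∀ z : A.domain, m * ‖(z : X)‖ ^ 2 ≤ (⟪A z, (z : X)⟫_ℂ).re

/-- `A` has compact resolvent: for some `μ`, the operator `A - μ` is a bijection from its domain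
onto `X`, whose inverse `R` is a compact operator. -/
def HasCompactResolvent (A : X →ₗ.[ℂ] X) : Prop :=
  ∃ (μ : ℂ) (R : X →L[ℂ] X), IsCompactOperator R ∧
    (∀ x : X, ∃ z : A.domain, (z : X) = R x ∧ A z - μ • (z : X) = x) ∧
    (∀ z : A.domain, R (A z - μ • (z : X)) = (z : X))

/-- `C` is bounded from `X₂`, the domain of `A` with the norm `‖A z‖`, into `Y`. -/
def IsBoundedOnDomain (A : X →ₗ.[ℂ] X) (C : A.domain →ₗ[ℂ] Y) : Prop :=
  ∃ M : ℝ, ∀ z : A.domain, ‖C z‖ ≤ M * ‖A z‖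

/-- `z` is the solution `t ↦ exp (i t A) z₀`, `z₀ ∈ X₂`, of `z' = i A z`, `z 0 = z₀`. -/
def IsSolution (A : X →ₗ.[ℂ] X) (z₀ : A.domain) (z : ℝ → A.domain) : Prop :=
  z 0 = z₀ ∧ ∀ t : ℝ, HasDerivAt (fun s => (z s : X)) (Complex.I • A (z t)) t

/-- `C` is an admissible observation operator. -/
def IsAdmissible (A : X →ₗ.[ℂ] X) (C : A.domain →ₗ[ℂ] Y) : Prop :=
  ∀ T : ℝ, 0 < T → ∃ K : ℝ, 0 < K ∧ ∀ (z₀ : A.domain) (z : ℝ → A.domain),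
    IsSolution A z₀ z → ∫ t in (0 : ℝ)..T, ‖C (z t)‖ ^ 2 ≤ K * ‖(z₀ : X)‖ ^ 2

/-- The `A`-frequency `λ(z) = ⟨A z, z⟩ / ‖z‖²`, used for `z ≠ 0` only. -/
noncomputable def frequency (A : X →ₗ.[ℂ] X) (z : A.domain) : ℝ :=
  (⟪A z, (z : X)⟫_ℂ).re / ‖(z : X)‖ ^ 2

/-- The coercivity condition for given functions `ε` and `ψ`. -/
def SpectrallyCoerciveWith (A : X →ₗ.[ℂ] X) (C : A.domain →ₗ[ℂ] Y) (ε ψ : ℝ → ℝ) : Prop :=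
  ∀ z : A.domain, z ≠ 0 →
    ‖A z‖ ^ 2 / ‖(z : X)‖ ^ 2 - frequency A z ^ 2 < ε (frequency A z) →
    ψ (frequency A z) * ‖(z : X)‖ ^ 2 ≤ ‖C z‖ ^ 2

/-- `C` is spectrally coercive. -/
def SpectrallyCoercive (A : X →ₗ.[ℂ] X) (C : A.domain →ₗ[ℂ] Y) : Prop :=
  ∃ ε ψ : ℝ → ℝ, IsDecreasingProfile ε ∧ IsDecreasingProfile ψ ∧ SpectrallyCoerciveWith A C ε ψ

/-- The system is weakly observable in time `T`. -/
def WeaklyObservableIn (A : X →ₗ.[ℂ] X) (C : A.domain →ₗ[ℂ] Y) (T : ℝ) : Prop :=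
  ∃ ψ : ℝ → ℝ, IsDecreasingProfile ψ ∧
    ∀ (z₀ : A.domain) (z : ℝ → A.domain), z₀ ≠ 0 → IsSolution A z₀ z →
      ψ (frequency A z₀) * ‖(z₀ : X)‖ ^ 2 ≤ ∫ t in (0 : ℝ)..T, ‖C (z t)‖ ^ 2

/-- `T > 0` solves the equation `T ε(θ₀ (1/T + l)) = θ₁` defining the observation time at
frequency `l`. -/
def IsObservationTime (θ₀ θ₁ : ℝ) (ε : ℝ → ℝ) (l T : ℝ) : Prop :=
  0 < T ∧ T * ε (θ₀ * (1 / T + l)) = θ₁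

/-- The weak observation inequality with frequency dependent observation time. -/
def WeakObservationInequality (A : X →ₗ.[ℂ] X) (C : A.domain →ₗ[ℂ] Y) (θ₀ θ₁ θ₂ : ℝ)
    (ε ψ : ℝ → ℝ) : Prop :=
  ∀ (z₀ : A.domain) (z : ℝ → A.domain), z₀ ≠ 0 → IsSolution A z₀ z →
    ∀ T₀ : ℝ, IsObservationTime θ₀ θ₁ ε (frequency A z₀) T₀ → ∀ T : ℝ, T₀ ≤ T →
      θ₂ * ψ (θ₀ * (1 / T + frequency A z₀)) * ‖(z₀ : X)‖ ^ 2
        ≤ ∫ t in (0 : ℝ)..T, ‖C (z t)‖ ^ 2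

end System

end WeakObservability

/-!
# Weak observability and spectral coercivity

The operator `A` has a compact positive inverse `B`, and the observation is `C z = D (A z)` with the
bounded operator `D = C B`. Approximating data by finite sums of eigenvectors of `B` produces the
orbits `ζ ↦ exp (i ζ A) w` on the closed upper half-plane for every `w : X`
(`IsPositiveInverse.exists_isFlow`): they are unitary on the real axis, and holomorphic and
exponentially decaying inside. Every solution of the system is such an orbit.

*Coercivity gives the observation inequality* (`SpectrallyCoerciveWith.weakObservationInequality`).
Expand `x(t) = sin (π t / T) z(t)` in a Fourier series on `[0, T]`, with coefficients `c n`. If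
`τ = 2 π n / T`, then `(A - τ) (c n)` is, up to a factor `i`, the Fourier coefficient of
`sin' · z`, so by Bessel's inequality these defects are small in square mean, of relative size
`(π / T) ^ 2`. In the same way the total energy of the `c n` is at most the frequency of `z₀` times
their total mass. Hence, apart from a fixed fraction of the mass, every `c n` has frequency at most
`Λ = 4 (1 / T + λ)` and is an `ε(Λ)`-approximate eigenvector, and coercivity applies to it. Bessel's
inequality for `C x` and Parseval's identity for `x` sum the estimates up. The conditions are met
when `(T ε(Λ)) ^ 2 ≥ 4 π ^ 2 ε(Λ)`, and this follows from `T ε(Λ) ≥ θ₁ = 2 π √E`.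

*Observability gives coercivity* (`spectrallyCoercive_of_observation`). If `A z₀ - λ z₀` is small,
the solution stays close to `exp (i λ t) z₀`, and by admissibility so does its observation.
The observation time may depend on the frequency, provided it has a continuous increasing bound.

*Coercivity gives observability in a fixed time* (`SpectrallyCoercive.weaklyObservableIn`). The
observation inequality needs a time growing with the frequency. On data of bounded frequency a
fixed time suffices, by compactness: a sequence of normalized data with vanishing observation on
`[0, T]` has a limit `w`, and `D (exp (i t A) w)` is constant on `[0, T]`. Since `A ≥ 0`, this
function extends holomorphically to the upper half-plane, so it is constant there
(`eq_zero_of_eq_zero_on_interval`), and by decay it is zero. Then the nonzero solution issued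
from `B w` is never observed, which contradicts the observation inequality. Finally a profile is
placed below the resulting sequence of constants (`exists_profile_le_seq`).
-/

namespace WeakObservability

open scoped InnerProductSpace Topology ComplexConjugate
open Set Filter

/-! ### Decreasing profiles and the observation time -/

section Profiles

variable {f g ε : ℝ → ℝ}

theorem IsDecreasingProfile.mul (hf : IsDecreasingProfile f) (hg : IsDecreasingProfile g) :
    IsDecreasingProfile (fun x => f x * g x) where
  continuousOn := hf.continuousOn.mul hg.continuousOn
  antitoneOn x hx y hy hxy :=
    mul_le_mul (hf.antitoneOn hx hy hxy) (hg.antitoneOn hx hy hxy) (hg.pos y hy).le (hf.pos x hx).le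
  pos x hx := mul_pos (hf.pos x hx) (hg.pos x hx)

theorem IsDecreasingProfile.const {c : ℝ} (hc : 0 < c) : IsDecreasingProfile (fun _ => c) where
  continuousOn := continuousOn_const
  antitoneOn _ _ _ _ _ := le_rfl
  pos _ _ := hc

theorem IsDecreasingProfile.min (hf : IsDecreasingProfile f) (hg : IsDecreasingProfile g) :
    IsDecreasingProfile (fun x => min (f x) (g x)) where
  continuousOn := ContinuousOn.inf hf.continuousOn hg.continuousOn
  antitoneOn _ hx _ hy hxy := min_le_min (hf.antitoneOn hx hy hxy) (hg.antitoneOn hx hy hxy)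
  pos x hx := lt_min (hf.pos x hx) (hg.pos x hx)

theorem IsDecreasingProfile.comp_affine (hf : IsDecreasingProfile f) {a b : ℝ} (ha : 0 ≤ a)
    (hb : 0 ≤ b) : IsDecreasingProfile (fun x => f (a * (b + x))) where
  continuousOn := hf.continuousOn.comp (by fun_prop)
    fun x hx => mul_nonneg ha (add_nonneg hb (mem_Ici.1 hx))
  antitoneOn x hx y hy hxy := hf.antitoneOn
    (mul_nonneg ha (add_nonneg hb (mem_Ici.1 hx))) (mul_nonneg ha (add_nonneg hb (mem_Ici.1 hy)))
    (by gcongr)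
  pos x hx := hf.pos _ (mul_nonneg ha (add_nonneg hb hx))

theorem IsDecreasingProfile.inv {τ : ℝ → ℝ} (hc : ContinuousOn τ (Ici 0))
    (hm : MonotoneOn τ (Ici 0)) (hp : ∀ x, 0 ≤ x → 0 < τ x) :
    IsDecreasingProfile (fun x => (τ x)⁻¹) where
  continuousOn := hc.inv₀ fun x hx => (hp x hx).ne'
  antitoneOn x hx _ hy hxy := inv_anti₀ (hp x hx) (hm hx hy hxy)
  pos x hx := inv_pos.2 (hp x hx)

/-- Below every positive decreasing sequence there is a profile: the largest `1`-Lipschitz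
decreasing function staying below the sequence. -/
theorem exists_profile_le_seq (d : ℕ → ℝ) (hd : ∀ n, 0 < d n) (hanti : Antitone d) :
    ∃ ψ, IsDecreasingProfile ψ ∧ ∀ (n : ℕ) (x : ℝ), n ≤ x → ψ x ≤ d n := by
  have hbdd (x : ℝ) : BddBelow (range fun n : ℕ => d n + max (n - x) 0) :=
    ⟨0, by rintro _ ⟨n, rfl⟩; exact add_nonneg (hd n).le (le_max_right _ _)⟩
  refine ⟨fun x => ⨅ n : ℕ, (d n + max (n - x) 0), ⟨?_, ?_, ?_⟩, fun n x hx => ?_⟩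
  · refine (LipschitzWith.of_le_add fun x y => ?_).continuous.continuousOn
    rw [← sub_le_iff_le_add]
    refine le_ciInf fun n => ?_
    rw [sub_le_iff_le_add]
    refine (ciInf_le (hbdd x) n).trans ?_
    rw [add_assoc]
    gcongr
    rw [Real.dist_eq]
    have := neg_abs_le (x - y)
    refine max_le ?_ (add_nonneg (le_max_right _ _) (abs_nonneg _))
    linarith [le_max_left ((n : ℝ) - y) 0]
  · intro x _ y _ hxy
    refine ciInf_mono (hbdd y) fun n => ?_
    gcongr
  · intro x hx
    refine lt_of_lt_of_le (lt_min (hd ⌈x + 1⌉₊) one_pos) (le_ciInf fun n => ?_)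
    rcases le_total n ⌈x + 1⌉₊ with h | h
    · exact (min_le_left _ _).trans ((hanti h).trans (le_add_of_nonneg_right (le_max_right _ _)))
    · have h1 : x + 1 ≤ n := (Nat.le_ceil _).trans (by exact_mod_cast h)
      refine (min_le_right _ _).trans ?_
      linarith [le_max_left ((n : ℝ) - x) 0, hd n]
  · refine (ciInf_le (hbdd x) n).trans ?_
    simp [hx]

/-- `ε(θ₀ (1 / T + l))` increases with `T` and decreases with `l`; hence `T ε(θ₀ (1 / T + l))` is
strictly increasing in `T`. -/
theorem profile_le_profile (hε : IsDecreasingProfile ε) {θ₀ l l' T T' : ℝ} (hθ₀ : 0 < θ₀)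
    (hl : 0 ≤ l) (hll' : l ≤ l') (hT : 0 < T) (hTT' : T ≤ T') :
    ε (θ₀ * (1 / T + l')) ≤ ε (θ₀ * (1 / T' + l)) := by
  have hT' := hT.trans_le hTT'
  refine hε.antitoneOn (mem_Ici.2 (by positivity)) (mem_Ici.2 ?_) ?_
  · have : 0 ≤ l' := hl.trans hll'
    positivity
  · have := one_div_le_one_div_of_le hT hTT'
    gcongr

theorem isObservationTime_mono (hε : IsDecreasingProfile ε) {θ₀ θ₁ l l' T T' : ℝ}
    (hθ₀ : 0 < θ₀) (hl : 0 ≤ l) (hll' : l ≤ l') (hT : IsObservationTime θ₀ θ₁ ε l T)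
    (hT' : IsObservationTime θ₀ θ₁ ε l' T') : T ≤ T' := by
  by_contra! h
  have h1 := profile_le_profile hε hθ₀ hl hll' hT'.1 h.le
  have h2 : 0 < ε (θ₀ * (1 / T + l)) := hε.pos _ (by have := hT.1; positivity)
  have h3 : T' * ε (θ₀ * (1 / T' + l')) < T * ε (θ₀ * (1 / T + l)) :=
    (mul_le_mul_of_nonneg_left h1 hT'.1.le).trans_lt (mul_lt_mul_of_pos_right h h2)
  rw [hT.2, hT'.2] at h3
  exact lt_irrefl _ h3

theorem exists_isObservationTime (hε : IsDecreasingProfile ε) {θ₀ θ₁ l : ℝ}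
    (hθ₀ : 0 < θ₀) (hθ₁ : 0 < θ₁) (hl : 0 ≤ l) : ∃ T, IsObservationTime θ₀ θ₁ ε l T := by
  have h0 := hε.pos 0 le_rfl
  have h1 := hε.pos (θ₀ * (1 + l)) (by positivity)
  -- At `a` the left-hand side is at most `θ₁` because `ε ≤ ε 0`; at `b ≥ 1` it is at least `θ₁`.
  set a := θ₁ / ε 0 with ha
  have ha0 : 0 < a := by positivity
  set b := max a (max 1 (θ₁ / ε (θ₀ * (1 + l)))) with hb
  have hab : a ≤ b := le_max_left _ _
  have hb1 : 1 ≤ b := (le_max_left _ _).trans (le_max_right _ _)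
  have hb2 : θ₁ / ε (θ₀ * (1 + l)) ≤ b := (le_max_right _ _).trans (le_max_right _ _)
  have hcont : ContinuousOn (fun T => T * ε (θ₀ * (1 / T + l))) (Icc a b) := by
    refine continuousOn_id.mul (hε.continuousOn.comp ?_ ?_)
    · refine continuousOn_const.mul ((continuousOn_const.div continuousOn_id ?_).add
        continuousOn_const)
      intro x hx
      exact (ha0.trans_le hx.1).ne'
    · intro x hx
      have : 0 < x := ha0.trans_le hx.1
      simp only [mem_Ici]
      positivity
  have hmem : θ₁ ∈ Icc (a * ε (θ₀ * (1 / a + l))) (b * ε (θ₀ * (1 / b + l))) := by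
    constructor
    · have : ε (θ₀ * (1 / a + l)) ≤ ε 0 :=
        hε.antitoneOn (mem_Ici.2 le_rfl) (mem_Ici.2 (by positivity)) (by positivity)
      calc a * ε (θ₀ * (1 / a + l)) ≤ a * ε 0 := by gcongr
        _ = θ₁ := by rw [ha]; field_simp
    · have := profile_le_profile hε hθ₀ hl le_rfl one_pos hb1
      rw [div_one] at this
      calc θ₁ = θ₁ / ε (θ₀ * (1 + l)) * ε (θ₀ * (1 + l)) := by field_simp
        _ ≤ b * ε (θ₀ * (1 / b + l)) := by gcongr
  obtain ⟨T, hT, hTe⟩ := intermediate_value_Icc hab hcont hmem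
  exact ⟨T, ha0.trans_le hT.1, hTe⟩

end Profiles

/-! ### Fourier coefficients of Hilbert space valued functions -/

section FourierSeries

variable {H : Type*} [NormedAddCommGroup H] [InnerProductSpace ℂ H]
variable {K : Type*} [NormedAddCommGroup K] [InnerProductSpace ℂ K]

/-- The Fourier mode `t ↦ exp (2 π i n t / T)` on the real line. -/
noncomputable def mode (T : ℝ) (n : ℤ) (t : ℝ) : ℂ := fourier n (t : AddCircle T)

/-- The `n`-th Fourier coefficient of the restriction of `f` to `[0, T]`. -/
noncomputable def fourierVec (T : ℝ) (f : ℝ → H) (n : ℤ) : H :=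
  (T : ℂ)⁻¹ • ∫ t in (0 : ℝ)..T, mode T (-n) t • f t

variable {T : ℝ}

@[fun_prop]
theorem continuous_mode (n : ℤ) : Continuous (mode T n) :=
  (map_continuous (fourier n)).comp (AddCircle.continuous_mk' T)

theorem conj_mode (n : ℤ) (t : ℝ) : conj (mode T n t) = mode T (-n) t := fourier_neg.symm

@[simp]
theorem norm_mode (n : ℤ) (t : ℝ) : ‖mode T n t‖ = 1 := Circle.norm_coe _

theorem mode_mul (m n : ℤ) (t : ℝ) : mode T m t * mode T n t = mode T (m + n) t :=
  fourier_add.symm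

theorem hasDerivAt_mode_neg (n : ℤ) (t : ℝ) : HasDerivAt (mode T (-n))
    (-(2 * Real.pi * Complex.I * n / T) * mode T (-n) t) t := by
  refine (hasDerivAt_fourier_neg T n t).congr_deriv ?_
  rw [mode]
  ring

theorem mode_period (n : ℤ) : mode T n T = mode T n 0 := by
  rw [mode, mode, AddCircle.coe_period, QuotientAddGroup.mk_zero]

theorem integral_mode (hT : 0 < T) (n : ℤ) :
    ∫ t in (0 : ℝ)..T, mode T n t = if n = 0 then (T : ℂ) else 0 := by
  have hT' : (T : ℂ) ≠ 0 := by exact_mod_cast hT.ne'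
  rcases eq_or_ne n 0 with rfl | hn
  · simp [mode]
  · rw [if_neg hn]
    have hd (t : ℝ) : HasDerivAt (fun s => (2 * Real.pi * Complex.I * n / T : ℂ)⁻¹ * mode T n s)
        (mode T n t) t := by
      have h0 : (2 * Real.pi * Complex.I * n / T : ℂ) ≠ 0 := by
        simp [hn, hT', Real.pi_ne_zero]
      refine ((hasDerivAt_fourier T n t).const_mul
        (2 * Real.pi * Complex.I * n / T : ℂ)⁻¹).congr_deriv ?_
      rw [← mul_assoc, inv_mul_cancel₀ h0, one_mul, mode]
    rw [intervalIntegral.integral_eq_sub_of_hasDerivAt (fun t _ => hd t)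
      ((continuous_mode n).intervalIntegrable _ _), mode_period, sub_self]

theorem fourierVec_comp [CompleteSpace H] [CompleteSpace K] (L : H →L[ℂ] K) {f : ℝ → H}
    (hf : Continuous f) (n : ℤ) :
    fourierVec T (fun t => L (f t)) n = L (fourierVec T f n) := by
  simp only [fourierVec, map_smul]
  rw [← L.intervalIntegral_comp_comm ((by fun_prop : Continuous fun t => mode T (-n) t • f t)
    |>.intervalIntegrable _ _)]
  simp

theorem fourierVec_add {f g : ℝ → H} (hf : Continuous f) (hg : Continuous g) (n : ℤ) :
    fourierVec T (fun t => f t + g t) n = fourierVec T f n + fourierVec T g n := by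
  simp only [fourierVec, smul_add]
  rw [intervalIntegral.integral_add, smul_add]
  all_goals exact Continuous.intervalIntegrable (by fun_prop) _ _

theorem fourierVec_const_smul (c : ℂ) (f : ℝ → H) (n : ℤ) :
    fourierVec T (fun t => c • f t) n = c • fourierVec T f n := by
  simp only [fourierVec, smul_comm _ c]
  rw [intervalIntegral.integral_smul, smul_comm]

theorem fourierVec_deriv [CompleteSpace H] {f f' : ℝ → H}
    (hf : ∀ t, HasDerivAt f (f' t) t) (hf' : Continuous f') (hper : f T = f 0) (n : ℤ) :
    fourierVec T f' n = (2 * Real.pi * Complex.I * n / T : ℂ) • fourierVec T f n := by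
  have hfc : Continuous f := continuous_iff_continuousAt.2 fun t => (hf t).continuousAt
  have h1 := intervalIntegral.integral_eq_sub_of_hasDerivAt (a := 0) (b := T)
    (fun t _ => (hasDerivAt_mode_neg (T := T) n t).smul (hf t))
    (Continuous.intervalIntegrable (by fun_prop) _ _)
  rw [intervalIntegral.integral_add, Pi.smul_apply', Pi.smul_apply', mode_period, hper,
    sub_self] at h1
  · simp only [mul_smul] at h1
    rw [intervalIntegral.integral_smul, neg_smul, ← sub_eq_add_neg, sub_eq_zero] at h1
    simp only [fourierVec]
    rw [h1, smul_comm]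
  all_goals exact Continuous.intervalIntegrable (by fun_prop) _ _

theorem fourierVec_sum_mode [CompleteSpace H] (hT : 0 < T) (S : Finset ℤ) (c : ℤ → H) {n : ℤ}
    (hn : n ∈ S) : fourierVec T (fun t => ∑ m ∈ S, mode T m t • c m) n = c n := by
  have hT' : (T : ℂ) ≠ 0 := by exact_mod_cast hT.ne'
  simp only [fourierVec, Finset.smul_sum, smul_smul, mode_mul]
  rw [intervalIntegral.integral_finsetSum]
  · simp only [intervalIntegral.integral_smul_const, integral_mode hT]
    rw [Finset.sum_eq_single n]
    · rw [if_pos (by lia), smul_smul, inv_mul_cancel₀ hT', one_smul]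
    · intro m _ hmn
      rw [if_neg (by lia), zero_smul]
    · exact fun h => absurd hn h
  · intro m _
    exact Continuous.intervalIntegrable (by fun_prop) _ _

theorem integral_inner_mode [CompleteSpace H] {g : ℝ → H} (hg : Continuous g) (hT : 0 < T)
    (v : H) (n : ℤ) :
    ∫ t in (0 : ℝ)..T, ⟪mode T n t • v, g t⟫_ℂ = T * ⟪v, fourierVec T g n⟫_ℂ := by
  have hT' : (T : ℂ) ≠ 0 := by exact_mod_cast hT.ne'
  simp only [inner_smul_left, conj_mode, ← inner_smul_right]
  have := (innerSL ℂ v).intervalIntegral_comp_comm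
    ((by fun_prop : Continuous fun t => mode T (-n) t • g t).intervalIntegrable
      (μ := MeasureTheory.volume) 0 T)
  simp only [innerSL_apply_apply] at this
  rw [this, fourierVec, smul_smul, mul_inv_cancel₀ hT', one_smul]

theorem integral_re {f : ℝ → ℂ} (hf : Continuous f) (a b : ℝ) :
    ∫ t in a..b, (f t).re = (∫ t in a..b, f t).re :=
  Complex.reCLM.intervalIntegral_comp_comm (hf.intervalIntegrable a b)

/-- Bessel's inequality for the semi-inner product of a positive operator `P`. -/
theorem bessel_form [CompleteSpace H] (hT : 0 < T) (P : H →L[ℂ] H)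
    (hsymm : ∀ u v, ⟪P u, v⟫_ℂ = ⟪u, P v⟫_ℂ) (hpos : ∀ u, 0 ≤ (⟪P u, u⟫_ℂ).re)
    {f : ℝ → H} (hf : Continuous f) (S : Finset ℤ) :
    ∑ n ∈ S, (⟪P (fourierVec T f n), fourierVec T f n⟫_ℂ).re
      ≤ T⁻¹ * ∫ t in (0 : ℝ)..T, (⟪P (f t), f t⟫_ℂ).re := by
  set c := fourierVec T f with hc
  set p : ℝ → H := fun t => ∑ n ∈ S, mode T n t • c n with hp
  have hpc : Continuous p := by fun_prop
  -- pairing the trigonometric polynomial `p` with a continuous function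
  have key {g : ℝ → H} (hg : Continuous g) : ∫ t in (0 : ℝ)..T, (⟪P (p t), g t⟫_ℂ).re
      = T * ∑ n ∈ S, (⟪P (c n), fourierVec T g n⟫_ℂ).re := by
    rw [integral_re (by fun_prop)]
    simp only [hp, map_sum, map_smul, sum_inner]
    rw [intervalIntegral.integral_finsetSum
      (fun n _ => Continuous.intervalIntegrable (by fun_prop) _ _)]
    simp only [integral_inner_mode hg hT, ← Finset.mul_sum]
    rw [Complex.re_ofReal_mul, Complex.re_sum]
  have h1 := key hf
  have h2 := key hpc
  rw [Finset.sum_congr rfl (fun n hn => by rw [fourierVec_sum_mode hT S c hn])] at h2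
  have h3 : 0 ≤ ∫ t in (0 : ℝ)..T, ((⟪P (f t), f t⟫_ℂ).re - 2 * (⟪P (p t), f t⟫_ℂ).re
      + (⟪P (p t), p t⟫_ℂ).re) := by
    refine intervalIntegral.integral_nonneg hT.le fun t _ => ?_
    have := hpos (f t - p t)
    have hs : (⟪P (f t), p t⟫_ℂ).re = (⟪P (p t), f t⟫_ℂ).re := by
      rw [hsymm, ← inner_conj_symm, Complex.conj_re]
    simp only [map_sub, inner_sub_left, inner_sub_right, Complex.sub_re, hs] at this
    linarith
  rw [intervalIntegral.integral_add, intervalIntegral.integral_sub,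
    intervalIntegral.integral_const_mul, h1, h2] at h3
  · rw [← div_eq_inv_mul, le_div_iff₀ hT]
    linarith
  all_goals exact Continuous.intervalIntegrable (by fun_prop) _ _

theorem bessel [CompleteSpace H] (hT : 0 < T) {f : ℝ → H} (hf : Continuous f) (S : Finset ℤ) :
    ∑ n ∈ S, ‖fourierVec T f n‖ ^ 2 ≤ T⁻¹ * ∫ t in (0 : ℝ)..T, ‖f t‖ ^ 2 := by
  have h (u : H) : (⟪u, u⟫_ℂ).re = ‖u‖ ^ 2 := inner_self_eq_norm_sq (𝕜 := ℂ) u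
  simpa only [ContinuousLinearMap.id_apply, h] using
    bessel_form hT (ContinuousLinearMap.id ℂ H) (fun _ _ => rfl)
    (fun u => (h u).ge.trans' (sq_nonneg _)) hf S

/-- The Fourier coefficients of a periodic `C¹` function are absolutely summable. -/
theorem summable_norm_fourierVec [CompleteSpace H] (hT : 0 < T) {f f' : ℝ → H}
    (hf : ∀ t, HasDerivAt f (f' t) t) (hf' : Continuous f') (hper : f T = f 0) :
    Summable (fun n => ‖fourierVec T f n‖) := by
  have h1 : Summable fun n => ‖fourierVec T f' n‖ ^ 2 :=
    summable_of_sum_le (fun _ => by positivity) (bessel hT hf')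
  have h2 : Summable fun n : ℤ => 1 / (n : ℝ) ^ 2 := Real.summable_one_div_int_pow.2 one_lt_two
  refine Summable.of_norm_bounded_eventually ((h2.add h1).mul_left (T / (2 * Real.pi))) ?_
  filter_upwards [(Set.finite_singleton (0 : ℤ)).compl_mem_cofinite] with n hn
  have hn0 : (n : ℝ) ≠ 0 := by exact_mod_cast hn
  have hn1 : 0 < |(n : ℝ)| := abs_pos.2 hn0
  have hpi := Real.pi_pos
  rw [fourierVec_deriv hf hf' hper, norm_smul, norm_norm]
  have : ‖(2 * Real.pi * Complex.I * n / T : ℂ)‖ = 2 * Real.pi * |(n : ℝ)| / T := by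
    simp [abs_of_pos hT, abs_of_pos hpi]
  rw [this]
  set x := ‖fourierVec T f n‖
  set a := |(n : ℝ)| with ha
  rw [← sq_abs (n : ℝ), ← ha]
  have h3 : x = T / (2 * Real.pi) * ((1 / a) * (2 * Real.pi * a / T * x)) := by field_simp
  calc x = T / (2 * Real.pi) * ((1 / a) * (2 * Real.pi * a / T * x)) := h3
    _ ≤ T / (2 * Real.pi) * (1 / a ^ 2 + (2 * Real.pi * a / T * x) ^ 2) := by
        gcongr
        rw [← one_div_pow]
        nlinarith [sq_nonneg (1 / a - 2 * Real.pi * a / T * x), sq_nonneg (1 / a),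
          sq_nonneg (2 * Real.pi * a / T * x)]

theorem hasSum_mode_smul_fourierVec [CompleteSpace H] (hT : 0 < T) {f : ℝ → H}
    (hf : Continuous f) (hper : f T = f 0) (hs : Summable (fun n => ‖fourierVec T f n‖))
    {t : ℝ} (ht : t ∈ Ioc 0 T) : HasSum (fun n => mode T n t • fourierVec T f n) (f t) := by
  have : Fact (0 < T) := ⟨hT⟩
  have hsum : Summable fun n => mode T n t • fourierVec T f n :=
    Summable.of_norm (by simpa [norm_smul] using hs)
  convert hsum.hasSum using 1
  refine ext_inner_left ℂ fun v => ?_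
  -- the scalar functions `⟨v, f⟩` are the sums of their Fourier series
  have hΦc : Continuous (AddCircle.liftIoc T 0 fun s => ⟪v, f s⟫_ℂ) := by
    rw [AddCircle.liftIoc_eq_liftIco (by simp [hper])]
    exact AddCircle.liftIco_continuous (by simp [hper]) (by fun_prop)
  set Φ : C(AddCircle T, ℂ) := ⟨_, hΦc⟩ with hΦ
  have hΦ_apply {s : ℝ} (hs : s ∈ Ioc 0 T) : Φ s = ⟪v, f s⟫_ℂ :=
    AddCircle.liftIoc_zero_coe_apply (f := fun s => ⟪v, f s⟫_ℂ) hs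
  have hcoeff (n : ℤ) : fourierCoeff Φ n = ⟪v, fourierVec T f n⟫_ℂ := by
    have h := fourierVec_comp (T := T) (innerSL ℂ v) hf n
    rw [innerSL_apply_apply] at h
    rw [fourierCoeff_eq_intervalIntegral _ _ 0, ← h, zero_add, fourierVec]
    simp only [innerSL_apply_apply]
    rw [Complex.real_smul]
    push_cast
    rw [one_div]
    refine congrArg (_ * ·) (intervalIntegral.integral_congr_ae (.of_forall fun s hs => ?_))
    rw [uIoc_of_le hT.le] at hs
    simp only [hΦ_apply hs, mode]
  have hsΦ : Summable (fourierCoeff Φ) := by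
    refine Summable.of_norm_bounded (hs.mul_left ‖v‖) fun n => ?_
    rw [hcoeff]
    exact norm_inner_le_norm _ _
  have h1 := has_pointwise_sum_fourier_series_of_summable hsΦ t
  have h2 := (innerSL ℂ v).hasSum hsum.hasSum
  rw [hΦ_apply ht] at h1
  refine h1.unique ?_
  rw [show (fun n => fourierCoeff Φ n • fourier n (t : AddCircle T))
      = fun n => innerSL ℂ v (mode T n t • fourierVec T f n) from
    funext fun n => by
      rw [hcoeff, innerSL_apply_apply, inner_smul_right, smul_eq_mul, mul_comm, mode]]
  exact h2

/-- Parseval's identity for a periodic `C¹` function with values in a Hilbert space. -/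
theorem parseval [CompleteSpace H] (hT : 0 < T) {f f' : ℝ → H}
    (hf : ∀ t, HasDerivAt f (f' t) t) (hf' : Continuous f') (hper : f T = f 0) :
    HasSum (fun n => ‖fourierVec T f n‖ ^ 2) (T⁻¹ * ∫ t in (0 : ℝ)..T, ‖f t‖ ^ 2) := by
  have hfc : Continuous f := continuous_iff_continuousAt.2 fun t => (hf t).continuousAt
  have hs := summable_norm_fourierVec hT hf hf' hper
  obtain ⟨M, hM⟩ := (isCompact_Icc (a := 0) (b := T)).exists_bound_of_continuousOn hfc.continuousOn
  have h1 := intervalIntegral.hasSum_integral_of_dominated_convergence (ι := ℤ)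
    (μ := MeasureTheory.volume) (a := 0) (b := T)
    (F := fun (n : ℤ) t => ⟪mode T n t • fourierVec T f n, f t⟫_ℂ) (f := fun t => ⟪f t, f t⟫_ℂ)
    (fun (n : ℤ) _ => ‖fourierVec T f n‖ * M)
    (fun n => (by fun_prop : Continuous _).aestronglyMeasurable)
    (fun n => .of_forall fun t ht => ?_)
    (.of_forall fun t _ => hs.mul_right M)
    (by simp)
    (.of_forall fun t ht => ?_)
  · simp only [integral_inner_mode hfc hT] at h1
    have h2 := (Complex.reCLM.hasSum h1).mul_left T⁻¹
    have e1 (n : ℤ) : T⁻¹ * Complex.reCLM (T * ⟪fourierVec T f n, fourierVec T f n⟫_ℂ)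
        = ‖fourierVec T f n‖ ^ 2 := by
      rw [Complex.reCLM_apply, Complex.re_ofReal_mul, inv_mul_cancel_left₀ hT.ne']
      exact inner_self_eq_norm_sq (𝕜 := ℂ) _
    have e2 : Complex.reCLM (∫ t in (0 : ℝ)..T, ⟪f t, f t⟫_ℂ) = ∫ t in (0 : ℝ)..T, ‖f t‖ ^ 2 := by
      rw [Complex.reCLM_apply, ← integral_re (by fun_prop)]
      exact intervalIntegral.integral_congr fun t _ => inner_self_eq_norm_sq (𝕜 := ℂ) _
    simpa only [e1, e2] using h2
  · rw [uIoc_of_le hT.le] at ht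
    refine (norm_inner_le_norm _ _).trans ?_
    rw [norm_smul, norm_mode, one_mul]
    exact mul_le_mul_of_nonneg_left (hM t ⟨ht.1.le, ht.2⟩) (norm_nonneg _)
  · rw [uIoc_of_le hT.le] at ht
    have h3 := (innerSL ℂ (f t)).hasSum (hasSum_mode_smul_fourierVec hT hfc hper hs ht)
    have h4 := Complex.hasSum_conj'.2 h3
    simpa [mul_comm] using h4

end FourierSeries

/-! ### The inverse of a strictly positive operator with compact resolvent -/

section Inverse

variable {X : Type*} [NormedAddCommGroup X] [InnerProductSpace ℂ X]

/-- `B` is the bounded inverse of the symmetric operator `A`, which is bounded below by `m > 0`. -/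
structure IsPositiveInverse (A : X →ₗ.[ℂ] X) (B : X →L[ℂ] X) (m : ℝ) : Prop where
  bound_pos : 0 < m
  bound_le : ∀ z : A.domain, m * ‖(z : X)‖ ^ 2 ≤ (⟪A z, (z : X)⟫_ℂ).re
  symm : ∀ z w : A.domain, ⟪A z, (w : X)⟫_ℂ = ⟪(z : X), A w⟫_ℂ
  exists_eq : ∀ x : X, ∃ z : A.domain, (z : X) = B x ∧ A z = x
  left_inv : ∀ z : A.domain, B (A z) = z

variable {A : X →ₗ.[ℂ] X}

theorem exists_isPositiveInverse [CompleteSpace X] (hA : IsSelfAdjoint A)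
    (hpos : IsStrictlyPositive A) (hres : HasCompactResolvent A) :
    ∃ (B : X →L[ℂ] X) (m : ℝ), IsPositiveInverse A B m ∧ IsCompactOperator B := by
  obtain ⟨m, hm, hbound⟩ := hpos
  obtain ⟨μ, R, hRc, hR1, hR2⟩ := hres
  have hinj (z : A.domain) (hz : A z = 0) : z = 0 := by
    have h := hbound z
    rw [hz, inner_zero_left, Complex.zero_re] at h
    have h2 : ‖(z : X)‖ ^ 2 = 0 := le_antisymm (by nlinarith) (by positivity)
    exact Subtype.ext (norm_eq_zero.1 (pow_eq_zero_iff two_ne_zero |>.1 h2))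
  have hsymm (z w : A.domain) : ⟪A z, (w : X)⟫_ℂ = ⟪(z : X), A w⟫_ℂ := by
    have h := LinearPMap.adjoint_isFormalAdjoint hA.dense_domain
    rw [LinearPMap.isSelfAdjoint_def.1 hA] at h
    exact h z w
  -- By the Fredholm alternative `1 + μ R` is invertible, and `A⁻¹ = R (1 + μ R)⁻¹`.
  obtain ⟨S, hS⟩ : ∃ S : X →L[ℂ] X, ∀ x, S x + μ • R (S x) = x := by
    rcases eq_or_ne μ 0 with rfl | hμ
    · exact ⟨ContinuousLinearMap.id ℂ X, fun x => by simp⟩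
    have hμ' : -μ⁻¹ ≠ 0 := neg_ne_zero.2 (inv_ne_zero hμ)
    rcases hRc.hasEigenvalue_or_mem_resolventSet hμ' with h | h
    · exfalso
      obtain ⟨v, hv, hv0⟩ := h.exists_hasEigenvector
      have hv' : R v = -μ⁻¹ • v := Module.End.mem_eigenspace_iff.1 hv
      obtain ⟨z, hz, hAz⟩ := hR1 v
      have h0 : A z = 0 := by
        rw [sub_eq_iff_eq_add] at hAz
        rw [hAz, hz, hv', smul_smul, mul_neg, mul_inv_cancel₀ hμ, neg_one_smul, add_neg_cancel]
      have hz0 := hinj z h0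
      rw [hz0, hv'] at hz
      exact hv0 ((smul_eq_zero.1 hz.symm).resolve_left hμ')
    · obtain ⟨u, hu⟩ := spectrum.mem_resolventSet_iff.1 h
      refine ⟨-μ⁻¹ • (↑u⁻¹ : X →L[ℂ] X), fun x => ?_⟩
      have h1 : (u : X →L[ℂ] X) ((↑u⁻¹ : X →L[ℂ] X) x) = x := by
        rw [← mul_apply_eq_comp, Units.mul_inv, one_apply_eq_self]
      rw [hu] at h1
      simp only [sub_apply, ContinuousLinearMap.algebraMap_apply,
        smul_apply, map_smul, smul_smul] at h1 ⊢
      rw [mul_neg, mul_inv_cancel₀ hμ, neg_one_smul, ← sub_eq_add_neg]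
      exact h1
  have hex (x : X) : ∃ z : A.domain, (z : X) = (R ∘L S) x ∧ A z = x := by
    obtain ⟨z, hz, hAz⟩ := hR1 (S x)
    refine ⟨z, hz, ?_⟩
    rw [sub_eq_iff_eq_add] at hAz
    rw [hAz, hz, hS]
  refine ⟨R ∘L S, m, ⟨hm, hbound, hsymm, hex, fun z => ?_⟩, hRc.comp_clm S⟩
  obtain ⟨z', hz', hAz'⟩ := hex (A z)
  have h0 : A (z' - z) = 0 := by rw [A.map_sub, hAz', sub_self]
  rw [← hz', sub_eq_zero.1 (hinj _ h0)]

namespace IsPositiveInverse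

variable {B : X →L[ℂ] X} {m : ℝ}

/-- `B x` as an element of the domain of `A`. -/
noncomputable def lift (h : IsPositiveInverse A B m) (x : X) : A.domain := (h.exists_eq x).choose

@[simp]
theorem coe_lift (h : IsPositiveInverse A B m) (x : X) : (h.lift x : X) = B x :=
  (h.exists_eq x).choose_spec.1

@[simp]
theorem apply_lift (h : IsPositiveInverse A B m) (x : X) : A (h.lift x) = x :=
  (h.exists_eq x).choose_spec.2

theorem lift_apply (h : IsPositiveInverse A B m) (z : A.domain) : h.lift (A z) = z :=
  Subtype.ext (by rw [coe_lift, h.left_inv])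

theorem symm_inv (h : IsPositiveInverse A B m) (x y : X) : ⟪B x, y⟫_ℂ = ⟪x, B y⟫_ℂ := by
  simpa using (h.symm (h.lift x) (h.lift y)).symm

theorem bound_le_inv (h : IsPositiveInverse A B m) (x : X) :
    m * ‖B x‖ ^ 2 ≤ (⟪x, B x⟫_ℂ).re := by
  simpa using h.bound_le (h.lift x)

theorem inner_inv_nonneg (h : IsPositiveInverse A B m) (x : X) : 0 ≤ (⟪x, B x⟫_ℂ).re :=
  (mul_nonneg h.bound_pos.le (sq_nonneg _)).trans (h.bound_le_inv x)

theorem inv_eq_zero (h : IsPositiveInverse A B m) {x : X} (hx : B x = 0) : x = 0 := by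
  have : h.lift x = 0 := Subtype.ext (by rw [coe_lift, hx]; rfl)
  rw [← h.apply_lift x, this, A.map_zero]

theorem frequency_lift (h : IsPositiveInverse A B m) (x : X) :
    frequency A (h.lift x) = (⟪x, B x⟫_ℂ).re / ‖B x‖ ^ 2 := by
  simp [frequency]

theorem norm_pos {z : A.domain} (hz : z ≠ 0) : 0 < ‖(z : X)‖ :=
  norm_pos_iff.2 fun h => hz (Subtype.ext h)

theorem frequency_nonneg (h : IsPositiveInverse A B m) (z : A.domain) : 0 ≤ frequency A z :=
  div_nonneg ((mul_nonneg h.bound_pos.le (sq_nonneg _)).trans (h.bound_le z)) (sq_nonneg _)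

theorem norm_sub_smul_sq (z : A.domain) (τ : ℝ) :
    ‖A z - (τ : ℂ) • (z : X)‖ ^ 2
      = ‖A z‖ ^ 2 - 2 * τ * (⟪A z, (z : X)⟫_ℂ).re + τ ^ 2 * ‖(z : X)‖ ^ 2 := by
  rw [@norm_sub_sq ℂ, inner_smul_right, norm_smul, mul_pow]
  simp
  ring

/-- Conservation of the norm for `u' = i A u`, where `g = A u`. -/
theorem norm_const (h : IsPositiveInverse A B m) {u g : ℝ → X} (hug : ∀ t, u t = B (g t))
    (hu : ∀ t, HasDerivAt u (Complex.I • g t) t) (t : ℝ) : ‖u t‖ = ‖u 0‖ := by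
  have hd (s : ℝ) : HasDerivAt (fun s => ⟪u s, u s⟫_ℂ) 0 s := by
    refine ((hu s).inner ℂ (hu s)).congr_deriv ?_
    rw [inner_smul_left, inner_smul_right, hug, h.symm_inv, Complex.conj_I]
    ring
  have hc : (⟪u t, u t⟫_ℂ) = ⟪u 0, u 0⟫_ℂ :=
    is_const_of_deriv_eq_zero (fun s => (hd s).differentiableAt) (fun s => (hd s).deriv) t 0
  rw [inner_self_eq_norm_sq_to_K, inner_self_eq_norm_sq_to_K] at hc
  have hc' : ‖u t‖ ^ 2 = ‖u 0‖ ^ 2 := by exact_mod_cast hc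
  exact (pow_left_inj₀ (norm_nonneg _) (norm_nonneg _) two_ne_zero).1 hc'

end IsPositiveInverse

end Inverse

/-! ### The unitary group and its extension to the upper half-plane -/

section Flow

variable {X : Type*} [NormedAddCommGroup X] [InnerProductSpace ℂ X]
variable {A : X →ₗ.[ℂ] X} {B : X →L[ℂ] X} {m : ℝ}

/-- `F` is an entire solution of `F' = i A F` with `F 0 = w`; here `G = A F`. -/
structure IsEntireSolution (B : X →L[ℂ] X) (w : X) (F G : ℂ → X) : Prop where
  init : F 0 = w
  eq_inv : ∀ ζ, F ζ = B (G ζ)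
  deriv : ∀ ζ, HasDerivAt F (Complex.I • G ζ) ζ

theorem IsEntireSolution.add {w w' : X} {F G F' G' : ℂ → X} (h : IsEntireSolution B w F G)
    (h' : IsEntireSolution B w' F' G') :
    IsEntireSolution B (w + w') (fun ζ => F ζ + F' ζ) (fun ζ => G ζ + G' ζ) where
  init := by rw [h.init, h'.init]
  eq_inv ζ := by rw [map_add, h.eq_inv, h'.eq_inv]
  deriv ζ := by rw [smul_add]; exact (h.deriv ζ).add (h'.deriv ζ)

theorem IsEntireSolution.sub {w w' : X} {F G F' G' : ℂ → X} (h : IsEntireSolution B w F G)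
    (h' : IsEntireSolution B w' F' G') :
    IsEntireSolution B (w - w') (fun ζ => F ζ - F' ζ) (fun ζ => G ζ - G' ζ) where
  init := by rw [h.init, h'.init]
  eq_inv ζ := by rw [map_sub, h.eq_inv, h'.eq_inv]
  deriv ζ := by rw [smul_sub]; exact (h.deriv ζ).sub (h'.deriv ζ)

/-- The algebraic sum of the eigenspaces of `B`. -/
noncomputable def eigenSum (B : X →L[ℂ] X) : Submodule ℂ X :=
  ⨆ μ, Module.End.eigenspace (B : Module.End ℂ X) μ

theorem IsPositiveInverse.exists_isEntireSolution (h : IsPositiveInverse A B m) {w : X}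
    (hw : w ∈ eigenSum B) : ∃ F G, IsEntireSolution B w F G := by
  refine Submodule.iSup_induction (motive := fun w => ∃ F G, IsEntireSolution B w F G) _ hw ?_ ?_ ?_
  · intro μ v hv
    have hv' : B v = μ • v := Module.End.mem_eigenspace_iff.1 hv
    rcases eq_or_ne μ 0 with rfl | hμ
    · have hv0 : v = 0 := h.inv_eq_zero (by rw [hv', zero_smul])
      exact ⟨fun _ => 0, fun _ => 0, by simp [hv0], fun _ => by simp, fun ζ => by
        simpa using hasDerivAt_const ζ (0 : X)⟩
    · refine ⟨fun ζ => Complex.exp (Complex.I * μ⁻¹ * ζ) • v,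
        fun ζ => Complex.exp (Complex.I * μ⁻¹ * ζ) • μ⁻¹ • v, by simp, fun ζ => ?_, fun ζ => ?_⟩
      · rw [map_smul, map_smul, hv', smul_smul μ⁻¹, inv_mul_cancel₀ hμ, one_smul]
      · have h1 : HasDerivAt (fun ζ : ℂ => Complex.exp (Complex.I * μ⁻¹ * ζ))
            (Complex.exp (Complex.I * μ⁻¹ * ζ) * (Complex.I * μ⁻¹)) ζ := by
          simpa using ((hasDerivAt_id ζ).const_mul (Complex.I * μ⁻¹)).cexp
        refine (h1.smul_const v).congr_deriv ?_
        rw [smul_smul, smul_smul]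
        congr 1
        ring
  · exact ⟨fun _ => 0, fun _ => 0, rfl, fun _ => by simp, fun ζ => by
        simpa using hasDerivAt_const ζ (0 : X)⟩
  · rintro v w ⟨F, G, hF⟩ ⟨F', G', hF'⟩
    exact ⟨_, _, hF.add hF'⟩

theorem IsPositiveInverse.dense_eigenSum [CompleteSpace X] (h : IsPositiveInverse A B m)
    (hB : IsCompactOperator B) : Dense (eigenSum B : Set X) := by
  rw [Submodule.dense_iff_topologicalClosure_eq_top, Submodule.topologicalClosure_eq_top_iff]
  exact ContinuousLinearMap.orthogonalComplement_iSup_eigenspaces_eq_bot hB h.symm_inv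

theorem IsEntireSolution.hasDerivAt_real {w : X} {F G : ℂ → X} (h : IsEntireSolution B w F G)
    (t : ℝ) : HasDerivAt (fun s : ℝ => F s) (Complex.I • G t) t := by
  simpa [Function.comp_def] using (h.deriv t).scomp t (Complex.ofRealCLM.hasDerivAt (x := t))

theorem IsEntireSolution.norm_real {w : X} {F G : ℂ → X} (h : IsEntireSolution B w F G)
    (hB : IsPositiveInverse A B m) (t : ℝ) : ‖F t‖ = ‖w‖ := by
  rw [hB.norm_const (fun s => h.eq_inv s) h.hasDerivAt_real t, Complex.ofReal_zero, h.init]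

theorem IsEntireSolution.inner_real {w : X} {F G : ℂ → X} (h : IsEntireSolution B w F G)
    (hB : IsPositiveInverse A B m) (t : ℝ) : ⟪F t, B (F t)⟫_ℂ = ⟪w, B w⟫_ℂ := by
  have hd (s : ℝ) : HasDerivAt (fun s : ℝ => ⟪F s, B (F s)⟫_ℂ) 0 s := by
    have h2 : HasDerivAt (fun s : ℝ => B (F s)) (B (Complex.I • G s)) s :=
      ((B.restrictScalars ℝ).hasFDerivAt.comp_hasDerivAt s (h.hasDerivAt_real s))
    refine ((h.hasDerivAt_real s).inner ℂ h2).congr_deriv ?_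
    rw [map_smul, ← h.eq_inv, inner_smul_left, inner_smul_right, ← hB.symm_inv, ← h.eq_inv,
      h.eq_inv, hB.symm_inv, Complex.conj_I, ← hB.symm_inv]
    ring
  have := is_const_of_deriv_eq_zero (fun s => (hd s).differentiableAt) (fun s => (hd s).deriv) t 0
  simpa [h.init] using this

/-- Along vertical lines the solution is `exp (-s A)` applied to a vector, which decays. -/
theorem IsEntireSolution.norm_le {w : X} {F G : ℂ → X} (h : IsEntireSolution B w F G)
    (hB : IsPositiveInverse A B m) {ζ : ℂ} (hζ : 0 ≤ ζ.im) :
    ‖F ζ‖ ≤ Real.exp (-m * ζ.im) * ‖w‖ := by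
  set u : ℝ → X := fun s => F (ζ.re + s * Complex.I) with hu_def
  set g : ℝ → X := fun s => G (ζ.re + s * Complex.I) with hg_def
  have hu (s : ℝ) : HasDerivAt u (-g s) s := by
    have h1 : HasDerivAt (fun s : ℝ => (ζ.re + s * Complex.I : ℂ)) Complex.I s := by
      simpa using (((hasDerivAt_id s).ofReal_comp).mul_const Complex.I).const_add (ζ.re : ℂ)
    refine ((h.deriv _).scomp s h1).congr_deriv ?_
    rw [smul_smul, Complex.I_mul_I, neg_one_smul]
  have hug (s : ℝ) : u s = B (g s) := h.eq_inv _
  have hd (s : ℝ) : HasDerivAt (fun s => Real.exp (2 * m * s) * (⟪u s, u s⟫_ℂ).re)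
      (Real.exp (2 * m * s) * (2 * m) * (⟪u s, u s⟫_ℂ).re
        + Real.exp (2 * m * s) * (-(2 * (⟪g s, B (g s)⟫_ℂ).re))) s := by
    have h1 : HasDerivAt (fun s => Real.exp (2 * m * s)) (Real.exp (2 * m * s) * (2 * m)) s := by
      simpa using ((hasDerivAt_id s).const_mul (2 * m)).exp
    refine h1.mul (((Complex.reCLM.hasFDerivAt.comp_hasDerivAt s
      ((hu s).inner ℂ (hu s)))).congr_deriv ?_)
    rw [inner_neg_left, inner_neg_right, Complex.reCLM_apply, hug, hB.symm_inv, Complex.add_re,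
      Complex.neg_re]
    ring
  have hanti : Antitone fun s => Real.exp (2 * m * s) * (⟪u s, u s⟫_ℂ).re := by
    refine antitone_of_deriv_nonpos (fun s => (hd s).differentiableAt) fun s => ?_
    rw [(hd s).deriv]
    have h1 : (⟪u s, u s⟫_ℂ).re = ‖B (g s)‖ ^ 2 := by
      rw [← hug]; exact inner_self_eq_norm_sq (𝕜 := ℂ) _
    have h2 := hB.bound_le_inv (g s)
    rw [h1]
    nlinarith [Real.exp_pos (2 * m * s)]
  have h1 := hanti hζ
  have hn (s : ℝ) : (⟪u s, u s⟫_ℂ).re = ‖u s‖ ^ 2 := inner_self_eq_norm_sq (𝕜 := ℂ) _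
  simp only [hn, mul_zero, Real.exp_zero, one_mul] at h1
  have hu0 : u 0 = F ζ.re := by simp [hu_def]
  have huζ : u ζ.im = F ζ := by simp [hu_def]
  rw [hu0, huζ, h.norm_real hB] at h1
  have h2 : (Real.exp (m * ζ.im) * ‖F ζ‖) ^ 2 ≤ ‖w‖ ^ 2 := by
    rw [mul_pow, ← Real.exp_nat_mul]
    refine le_of_eq_of_le ?_ h1
    congr 2
    push_cast
    ring
  have h3 := (pow_le_pow_iff_left₀ (by positivity) (norm_nonneg _) two_ne_zero).1 h2
  rw [neg_mul, Real.exp_neg, ← div_eq_inv_mul, le_div_iff₀ (Real.exp_pos _), mul_comm]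
  exact h3

/-- `F` is the orbit `ζ ↦ exp (i ζ A) w` on the closed upper half-plane, for any `w : X`.
It is holomorphic inside, unitary on the real axis, and there `B F` is differentiable although
`F` need not be. -/
structure IsFlow (B : X →L[ℂ] X) (m : ℝ) (w : X) (F : ℂ → X) : Prop where
  init : F 0 = w
  continuousOn : ContinuousOn F {ζ | 0 ≤ ζ.im}
  differentiableOn : DifferentiableOn ℂ F {ζ | 0 < ζ.im}
  norm_le : ∀ ζ : ℂ, 0 ≤ ζ.im → ‖F ζ‖ ≤ Real.exp (-m * ζ.im) * ‖w‖
  norm_real : ∀ t : ℝ, ‖F t‖ = ‖w‖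
  inner_real : ∀ t : ℝ, ⟪F t, B (F t)⟫_ℂ = ⟪w, B w⟫_ℂ
  hasDerivAt : ∀ t : ℝ, HasDerivAt (fun s : ℝ => B (F s)) (Complex.I • F t) t

theorem IsFlow.continuous_real {w : X} {F : ℂ → X} (h : IsFlow B m w F) :
    Continuous (fun t : ℝ => F t) := by
  refine h.continuousOn.comp_continuous Complex.continuous_ofReal fun t => ?_
  simp

theorem IsPositiveInverse.exists_isFlow [CompleteSpace X] (h : IsPositiveInverse A B m)
    (hB : IsCompactOperator B) (w : X) : ∃ F, IsFlow B m w F := by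
  obtain ⟨v, hv, hvw⟩ := mem_closure_iff_seq_limit.1 (h.dense_eigenSum hB w)
  choose F G hFG using fun n => h.exists_isEntireSolution (hv n)
  have hle (a b : ℕ) (ζ : ℂ) (hζ : 0 ≤ ζ.im) : ‖F a ζ - F b ζ‖ ≤ ‖v a - v b‖ := by
    refine (((hFG a).sub (hFG b)).norm_le h hζ).trans (mul_le_of_le_one_left (norm_nonneg _) ?_)
    rw [Real.exp_le_one_iff]
    nlinarith [h.bound_pos]
  have hcauchy := Metric.cauchySeq_iff.1 hvw.cauchySeq
  have hptc (ζ : ℂ) (hζ : 0 ≤ ζ.im) : ∃ y, Tendsto (fun n => F n ζ) atTop (𝓝 y) := by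
    refine cauchySeq_tendsto_of_complete (Metric.cauchySeq_iff.2 fun ε hε => ?_)
    obtain ⟨N, hN⟩ := hcauchy ε hε
    refine ⟨N, fun a ha b hb => ?_⟩
    have := hN a ha b hb
    rw [dist_eq_norm] at this ⊢
    exact (hle a b ζ hζ).trans_lt this
  choose! L hL using hptc
  have hunif : TendstoUniformlyOn F L atTop {ζ | 0 ≤ ζ.im} := by
    refine UniformCauchySeqOn.tendstoUniformlyOn_of_tendsto ?_ fun ζ hζ => hL ζ hζ
    refine Metric.uniformCauchySeqOn_iff.2 fun ε hε => ?_
    obtain ⟨N, hN⟩ := hcauchy ε hε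
    refine ⟨N, fun a ha b hb ζ hζ => ?_⟩
    have := hN a ha b hb
    rw [dist_eq_norm] at this ⊢
    exact (hle a b ζ hζ).trans_lt this
  have hr (t : ℝ) : (0 : ℝ) ≤ (t : ℂ).im := by simp
  have hLr (t : ℝ) := hL t (hr t)
  refine ⟨L, ?_, ?_, ?_, fun ζ hζ => ?_, fun t => ?_, fun t => ?_, fun t => ?_⟩
  · refine tendsto_nhds_unique (hL 0 le_rfl) ?_
    simpa only [(hFG _).init] using hvw
  · exact hunif.continuousOn (Eventually.frequently (.of_forall fun n =>
      (continuous_iff_continuousAt.2 fun ζ => ((hFG n).deriv ζ).continuousAt).continuousOn))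
  · refine TendstoLocallyUniformlyOn.differentiableOn
      (hunif.mono fun ζ (hζ : 0 < ζ.im) => hζ.le).tendstoLocallyUniformlyOn
      (.of_forall fun n ζ _ => ((hFG n).deriv ζ).differentiableAt.differentiableWithinAt)
      (isOpen_lt continuous_const Complex.continuous_im)
  · exact le_of_tendsto_of_tendsto' (hL ζ hζ).norm (hvw.norm.const_mul _)
      fun n => (hFG n).norm_le h hζ
  · refine tendsto_nhds_unique (hLr t).norm ?_
    simpa only [(hFG _).norm_real h] using hvw.norm
  · refine tendsto_nhds_unique ((hLr t).inner ((B.continuous.tendsto _).comp (hLr t))) ?_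
    simpa only [Function.comp_def, (hFG _).inner_real h] using
      hvw.inner ((B.continuous.tendsto _).comp hvw)
  · refine hasDerivAt_of_tendstoUniformly (l := atTop) (f := fun n (s : ℝ) => B (F n s))
      (f' := fun n s => Complex.I • F n s) (g' := fun s : ℝ => Complex.I • L s) ?_ ?_ ?_ t
    · have h1 : TendstoUniformly (fun n (s : ℝ) => F n s) (fun s : ℝ => L s) atTop := by
        rw [← tendstoUniformlyOn_univ]
        exact (hunif.comp (fun s : ℝ => (s : ℂ))).mono fun s _ => hr s
      exact (Complex.I • ContinuousLinearMap.id ℂ X).uniformContinuous.comp_tendstoUniformly h1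
    · refine .of_forall fun n s => ?_
      have := (B.restrictScalars ℝ).hasFDerivAt.comp_hasDerivAt s ((hFG n).hasDerivAt_real s)
      refine this.congr_deriv ?_
      rw [(hFG n).eq_inv, ContinuousLinearMap.coe_restrictScalars', map_smul]
    · exact fun s => (B.continuous.tendsto _).comp (hLr s)

theorem IsFlow.isSolution {w : X} {F : ℂ → X} (hF : IsFlow B m w F)
    (h : IsPositiveInverse A B m) : IsSolution A (h.lift w) (fun t => h.lift (F t)) := by
  refine ⟨by simp [hF.init], fun t => ?_⟩
  simpa using hF.hasDerivAt t

/-- Solutions are unique, hence given by the orbit of `A z₀`. -/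
theorem IsSolution.eq_flow {z₀ : A.domain} {z : ℝ → A.domain} {F : ℂ → X}
    (hz : IsSolution A z₀ z) (h : IsPositiveInverse A B m) (hF : IsFlow B m (A z₀) F) (t : ℝ) :
    A (z t) = F t := by
  have h1 := h.norm_const (u := fun t => (z t : X) - B (F t)) (g := fun t => A (z t) - F t)
    (fun s => by rw [map_sub, h.left_inv])
    (fun s => by rw [smul_sub]; exact (hz.2 s).sub (hF.hasDerivAt s)) t
  have h2 : (z 0 : X) - B (F (0 : ℝ)) = 0 := by
    rw [hz.1, Complex.ofReal_zero, hF.init, h.left_inv, sub_self]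
  simp only [h2, norm_zero, norm_eq_zero] at h1
  rw [← h.left_inv, ← map_sub] at h1
  exact sub_eq_zero.1 (h.inv_eq_zero h1)

end Flow

/-! ### The weak observation inequality -/

section Observation

variable {X : Type*} [NormedAddCommGroup X] [InnerProductSpace ℂ X]
variable {Y : Type*} [NormedAddCommGroup Y] [InnerProductSpace ℂ Y]
variable {A : X →ₗ.[ℂ] X} {B : X →L[ℂ] X} {m : ℝ} {C : A.domain →ₗ[ℂ] Y} {D : X →L[ℂ] Y}

/-- In terms of `w = A z`, the observation `C z` is a bounded operator `D = C A⁻¹`. -/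
theorem IsPositiveInverse.exists_observation (h : IsPositiveInverse A B m)
    (hC : IsBoundedOnDomain A C) : ∃ D : X →L[ℂ] Y, ∀ z, C z = D (A z) := by
  obtain ⟨M, hM⟩ := hC
  let L : X →ₗ[ℂ] A.domain :=
    { toFun := h.lift
      map_add' := fun x y => Subtype.ext (by simp)
      map_smul' := fun c x => Subtype.ext (by simp) }
  refine ⟨(C ∘ₗ L).mkContinuous M fun x => ?_, fun z => ?_⟩
  · simpa using! hM (h.lift x)
  · exact congrArg C (h.lift_apply z).symm

section Solutions

variable {z₀ : A.domain} {z : ℝ → A.domain}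

theorem IsSolution.norm_eq (hz : IsSolution A z₀ z) (h : IsPositiveInverse A B m) (t : ℝ) :
    ‖(z t : X)‖ = ‖(z₀ : X)‖ := by
  rw [h.norm_const (u := fun t => (z t : X)) (fun s => (h.left_inv (z s)).symm) hz.2 t, hz.1]

theorem IsSolution.continuous (hz : IsSolution A z₀ z) : Continuous fun t => (z t : X) :=
  continuous_iff_continuousAt.2 fun t => (hz.2 t).continuousAt

variable [CompleteSpace X]

theorem IsSolution.continuous_apply (hz : IsSolution A z₀ z) (h : IsPositiveInverse A B m)
    (hB : IsCompactOperator B) : Continuous fun t => A (z t) := by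
  obtain ⟨F, hF⟩ := h.exists_isFlow hB (A z₀)
  simpa only [hz.eq_flow h hF] using hF.continuous_real

theorem IsSolution.norm_apply (hz : IsSolution A z₀ z) (h : IsPositiveInverse A B m)
    (hB : IsCompactOperator B) (t : ℝ) : ‖A (z t)‖ = ‖A z₀‖ := by
  obtain ⟨F, hF⟩ := h.exists_isFlow hB (A z₀)
  rw [hz.eq_flow h hF, hF.norm_real]

theorem IsSolution.inner_eq (hz : IsSolution A z₀ z) (h : IsPositiveInverse A B m)
    (hB : IsCompactOperator B) (t : ℝ) : ⟪A (z t), (z t : X)⟫_ℂ = ⟪A z₀, (z₀ : X)⟫_ℂ := by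
  obtain ⟨F, hF⟩ := h.exists_isFlow hB (A z₀)
  have := hF.inner_real t
  rwa [← hz.eq_flow h hF, h.left_inv, h.left_inv] at this

theorem IsSolution.continuous_observation (hz : IsSolution A z₀ z) (h : IsPositiveInverse A B m)
    (hB : IsCompactOperator B) (hD : ∀ z, C z = D (A z)) : Continuous fun t => C (z t) := by
  simp only [hD]
  exact D.continuous.comp (hz.continuous_apply h hB)

end Solutions

/-- Either `B x` has frequency above `Λ`, or it is far from being an approximate eigenvector for
`τ`, or spectral coercivity applies to it; in each case one of the three terms dominates. -/
theorem SpectrallyCoerciveWith.norm_sq_le (h : IsPositiveInverse A B m)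
    (hD : ∀ z, C z = D (A z)) {ε ψ : ℝ → ℝ} (hε : IsDecreasingProfile ε)
    (hψ : IsDecreasingProfile ψ) (hsc : SpectrallyCoerciveWith A C ε ψ) {Λ : ℝ} (hΛ : 0 < Λ)
    (τ : ℝ) (x : X) :
    ‖B x‖ ^ 2 ≤ (ψ Λ)⁻¹ * ‖D x‖ ^ 2 + Λ⁻¹ * (⟪B x, x⟫_ℂ).re
      + (ε Λ)⁻¹ * ‖x - (τ : ℂ) • B x‖ ^ 2 := by
  have hεΛ := hε.pos Λ hΛ.le
  have hψΛ := hψ.pos Λ hΛ.le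
  have hq : 0 ≤ (⟪B x, x⟫_ℂ).re := by rw [h.symm_inv]; exact h.inner_inv_nonneg x
  have t1 : 0 ≤ (ψ Λ)⁻¹ * ‖D x‖ ^ 2 := by positivity
  have t2 : 0 ≤ Λ⁻¹ * (⟪B x, x⟫_ℂ).re := by positivity
  have t3 : 0 ≤ (ε Λ)⁻¹ * ‖x - (τ : ℂ) • B x‖ ^ 2 := by positivity
  rcases eq_or_ne (B x) 0 with hx | hx
  · rw [hx] at t2 t3 ⊢
    simp only [norm_zero, ne_eq, OfNat.ofNat_ne_zero, not_false_eq_true, zero_pow]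
    positivity
  set z := h.lift x with hz
  have hzB : (z : X) = B x := h.coe_lift x
  have hAz : A z = x := h.apply_lift x
  have hz0 : z ≠ 0 := fun h0 => hx (by rw [← hzB, h0]; rfl)
  have hn : 0 < ‖B x‖ ^ 2 := by have := norm_pos_iff.2 hx; positivity
  have hfreq : frequency A z = (⟪B x, x⟫_ℂ).re / ‖B x‖ ^ 2 := by
    rw [hz, h.frequency_lift, h.symm_inv]
  have hf0 := h.frequency_nonneg z
  rcases lt_or_ge Λ (frequency A z) with hfΛ | hfΛ
  · have : ‖B x‖ ^ 2 ≤ Λ⁻¹ * (⟪B x, x⟫_ℂ).re := by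
      rw [hfreq, lt_div_iff₀ hn] at hfΛ
      rw [← div_eq_inv_mul, le_div_iff₀ hΛ, mul_comm]
      exact hfΛ.le
    linarith
  rcases le_or_gt (ε Λ * ‖B x‖ ^ 2) (‖x - (τ : ℂ) • B x‖ ^ 2) with hfar | hnear
  · have : ‖B x‖ ^ 2 ≤ (ε Λ)⁻¹ * ‖x - (τ : ℂ) • B x‖ ^ 2 := by
      rw [← div_eq_inv_mul, le_div_iff₀ hεΛ, mul_comm]
      exact hfar
    linarith
  have hexp := IsPositiveInverse.norm_sub_smul_sq z τ
  rw [hzB, hAz] at hexp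
  have hre : (⟪x, B x⟫_ℂ).re = frequency A z * ‖B x‖ ^ 2 := by
    rw [hfreq, ← h.symm_inv, div_mul_cancel₀ _ hn.ne']
  rw [hexp, hre] at hnear
  have hcond : ‖A z‖ ^ 2 / ‖(z : X)‖ ^ 2 - frequency A z ^ 2 < ε (frequency A z) := by
    have h1 : ε Λ ≤ ε (frequency A z) := hε.antitoneOn (mem_Ici.2 hf0) (mem_Ici.2 hΛ.le) hfΛ
    refine lt_of_lt_of_le ?_ h1
    rw [hzB, hAz, sub_lt_iff_lt_add, div_lt_iff₀ hn]
    nlinarith [mul_nonneg (sq_nonneg (τ - frequency A z)) hn.le]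
  have hobs := hsc z hz0 hcond
  rw [hD, hzB, hAz] at hobs
  have h2 : ψ Λ ≤ ψ (frequency A z) := hψ.antitoneOn (mem_Ici.2 hf0) (mem_Ici.2 hΛ.le) hfΛ
  have : ‖B x‖ ^ 2 ≤ (ψ Λ)⁻¹ * ‖D x‖ ^ 2 := by
    rw [← div_eq_inv_mul, le_div_iff₀ hψΛ, mul_comm]
    exact (mul_le_mul_of_nonneg_right h2 hn.le).trans hobs
  linarith

theorem integral_sin_sq_div {T : ℝ} (hT : 0 < T) :
    ∫ t in (0 : ℝ)..T, Real.sin (Real.pi / T * t) ^ 2 = T / 2 := by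
  have hc : Real.pi / T ≠ 0 := (div_pos Real.pi_pos hT).ne'
  rw [intervalIntegral.integral_comp_mul_left (fun s => Real.sin s ^ 2) hc, integral_sin_sq,
    div_mul_cancel₀ _ hT.ne']
  simp only [mul_zero, Real.sin_zero, Real.sin_pi, smul_eq_mul]
  have := Real.pi_pos
  field_simp
  ring

theorem integral_cos_sq_div {T : ℝ} (hT : 0 < T) :
    ∫ t in (0 : ℝ)..T, Real.cos (Real.pi / T * t) ^ 2 = T / 2 := by
  have hc : Real.pi / T ≠ 0 := (div_pos Real.pi_pos hT).ne'
  rw [intervalIntegral.integral_comp_mul_left (fun s => Real.cos s ^ 2) hc, integral_cos_sq,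
    div_mul_cancel₀ _ hT.ne']
  simp only [mul_zero, Real.sin_zero, Real.sin_pi, smul_eq_mul]
  have := Real.pi_pos
  field_simp
  ring

/-- The observation inequality on `[0, T]` with the cutoff `sin (π t / T)`, in the unoptimized
form that holds for every cutoff frequency `Λ`. -/
theorem SpectrallyCoerciveWith.integral_le [CompleteSpace X] [CompleteSpace Y]
    (h : IsPositiveInverse A B m) (hB : IsCompactOperator B)
    (hD : ∀ z, C z = D (A z)) {ε ψ : ℝ → ℝ} (hε : IsDecreasingProfile ε)
    (hψ : IsDecreasingProfile ψ) (hsc : SpectrallyCoerciveWith A C ε ψ) {Λ : ℝ} (hΛ : 0 < Λ)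
    {z₀ : A.domain} {z : ℝ → A.domain} (hz : IsSolution A z₀ z) {T : ℝ} (hT : 0 < T) :
    T / 2 * ‖(z₀ : X)‖ ^ 2 ≤ (ψ Λ)⁻¹ * (∫ t in (0 : ℝ)..T, ‖C (z t)‖ ^ 2)
      + Λ⁻¹ * (T / 2 * (⟪A z₀, (z₀ : X)⟫_ℂ).re)
      + (ε Λ)⁻¹ * (T / 2 * ((Real.pi / T) ^ 2 * ‖(z₀ : X)‖ ^ 2)) := by
  set κ := Real.pi / T with hκ
  have hac := hz.continuous_apply h hB
  have hzc := hz.continuous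
  -- `x = χ z` and its derivative `χ' z + i A x`, with `χ t = sin (π t / T)`
  set a : ℝ → X := fun t => (Real.sin (κ * t) : ℂ) • A (z t) with ha
  set b : ℝ → X := fun t => (κ * Real.cos (κ * t) : ℂ) • (z t : X) with hb
  have hac' : Continuous a := Continuous.smul (by fun_prop) hac
  have hbc' : Continuous b := by fun_prop
  have hx (t : ℝ) : HasDerivAt (fun t => B (a t)) (b t + Complex.I • a t) t := by
    have h1 : HasDerivAt (fun t : ℝ => (Real.sin (κ * t) : ℂ)) (κ * Real.cos (κ * t) : ℂ) t := by
      have := (((hasDerivAt_id t).const_mul κ).sin).ofReal_comp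
      refine this.congr_deriv ?_
      simp only [id, mul_one]
      push_cast
      ring
    have h2 := h1.smul (hz.2 t)
    have h3 : (fun t => B (a t)) = fun t => (Real.sin (κ * t) : ℂ) • (z t : X) := by
      funext s
      rw [ha, map_smul, h.left_inv]
    rw [h3]
    refine h2.congr_deriv ?_
    rw [smul_comm, add_comm]
  have hper : B (a T) = B (a 0) := by
    have : κ * T = Real.pi := div_mul_cancel₀ _ hT.ne'
    simp only [ha]
    rw [this]
    simp
  have hsum := parseval hT hx (by fun_prop) hper
  have hder (n : ℤ) : fourierVec T a n - ((2 * Real.pi * n / T : ℝ) : ℂ) • B (fourierVec T a n)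
      = Complex.I • fourierVec T b n := by
    have h1 := fourierVec_deriv hx (by fun_prop) hper n
    rw [fourierVec_add hbc' (by fun_prop), fourierVec_const_smul, fourierVec_comp B hac'] at h1
    have h2 := congrArg (fun v => Complex.I • v) h1
    simp only [smul_add, smul_smul, Complex.I_mul_I] at h2
    rw [neg_one_smul] at h2
    have h3 : ((2 * Real.pi * n / T : ℝ) : ℂ)
        = -(Complex.I * (2 * Real.pi * Complex.I * n / T)) := by
      push_cast
      linear_combination (2 * Real.pi * n / T : ℂ) * Complex.I_mul_I
    rw [h3, neg_smul, ← h2]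
    abel
  have hle : T⁻¹ * ∫ t in (0 : ℝ)..T, ‖B (a t)‖ ^ 2
      ≤ (ψ Λ)⁻¹ * (T⁻¹ * ∫ t in (0 : ℝ)..T, ‖D (a t)‖ ^ 2)
        + Λ⁻¹ * (T⁻¹ * ∫ t in (0 : ℝ)..T, (⟪B (a t), a t⟫_ℂ).re)
        + (ε Λ)⁻¹ * (T⁻¹ * ∫ t in (0 : ℝ)..T, ‖b t‖ ^ 2) := by
    refine hasSum_le_of_sum_le hsum fun S => ?_
    have hεΛ := hε.pos Λ hΛ.le
    have hψΛ := hψ.pos Λ hΛ.le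
    have b1 := bessel hT (D.continuous.comp hac') S
    have b2 := bessel_form hT B h.symm_inv
      (fun u => by rw [h.symm_inv]; exact h.inner_inv_nonneg u) hac' S
    have b3 := bessel hT hbc' S
    calc ∑ n ∈ S, ‖fourierVec T (fun t => B (a t)) n‖ ^ 2
        ≤ ∑ n ∈ S, ((ψ Λ)⁻¹ * ‖fourierVec T (D ∘ a) n‖ ^ 2
          + Λ⁻¹ * (⟪B (fourierVec T a n), fourierVec T a n⟫_ℂ).re
          + (ε Λ)⁻¹ * ‖fourierVec T b n‖ ^ 2) := by
          refine Finset.sum_le_sum fun n _ => ?_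
          have h1 := hsc.norm_sq_le h hD hε hψ hΛ (2 * Real.pi * n / T) (fourierVec T a n)
          rw [hder, norm_smul, Complex.norm_I, one_mul, ← fourierVec_comp D hac',
            ← fourierVec_comp B hac'] at h1
          rw [← fourierVec_comp B hac']
          exact h1
      _ ≤ _ := by
          rw [Finset.sum_add_distrib, Finset.sum_add_distrib, ← Finset.mul_sum, ← Finset.mul_sum,
            ← Finset.mul_sum]
          gcongr
          exact b1
  have i1 : ∫ t in (0 : ℝ)..T, ‖B (a t)‖ ^ 2 = T / 2 * ‖(z₀ : X)‖ ^ 2 := by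
    rw [← integral_sin_sq_div hT, ← intervalIntegral.integral_mul_const]
    refine intervalIntegral.integral_congr fun t _ => ?_
    simp only [ha]
    rw [map_smul, h.left_inv, norm_smul, hz.norm_eq h, Complex.norm_real, mul_pow,
      Real.norm_eq_abs, sq_abs]
  have i2 : ∫ t in (0 : ℝ)..T, (⟪B (a t), a t⟫_ℂ).re = T / 2 * (⟪A z₀, (z₀ : X)⟫_ℂ).re := by
    rw [← integral_sin_sq_div hT, ← intervalIntegral.integral_mul_const]
    refine intervalIntegral.integral_congr fun t _ => ?_
    simp only [ha]
    rw [h.symm_inv, map_smul, h.left_inv, inner_smul_left, inner_smul_right, hz.inner_eq h hB,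
      Complex.conj_ofReal, ← mul_assoc, ← Complex.ofReal_mul, Complex.re_ofReal_mul, sq]
  have i3 : ∫ t in (0 : ℝ)..T, ‖b t‖ ^ 2 = T / 2 * (κ ^ 2 * ‖(z₀ : X)‖ ^ 2) := by
    rw [← integral_cos_sq_div hT, ← intervalIntegral.integral_mul_const]
    refine intervalIntegral.integral_congr fun t _ => ?_
    simp only [hb]
    rw [norm_smul, hz.norm_eq h, ← Complex.ofReal_mul, Complex.norm_real, mul_pow,
      Real.norm_eq_abs, sq_abs, mul_pow]
    ring
  have i4 : ∫ t in (0 : ℝ)..T, ‖D (a t)‖ ^ 2 ≤ ∫ t in (0 : ℝ)..T, ‖C (z t)‖ ^ 2 := by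
    have hCc := hz.continuous_observation h hB hD
    refine intervalIntegral.integral_mono_on hT.le (Continuous.intervalIntegrable (by fun_prop) _ _)
      ((hCc.norm.pow 2).intervalIntegrable _ _) fun t _ => ?_
    simp only [ha]
    rw [hD, map_smul, norm_smul, Complex.norm_real, mul_pow, Real.norm_eq_abs, sq_abs]
    exact mul_le_of_le_one_left (sq_nonneg _) (Real.sin_sq_le_one _)
  rw [i1, i2, i3] at hle
  have hψΛ := hψ.pos Λ hΛ.le
  have hmul := mul_le_mul_of_nonneg_left hle hT.le
  have e : T * T⁻¹ = 1 := mul_inv_cancel₀ hT.ne'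
  have h5 : (ψ Λ)⁻¹ * ∫ t in (0 : ℝ)..T, ‖D (a t)‖ ^ 2
      ≤ (ψ Λ)⁻¹ * ∫ t in (0 : ℝ)..T, ‖C (z t)‖ ^ 2 := by gcongr
  have h6 : T * (T⁻¹ * (T / 2 * ‖(z₀ : X)‖ ^ 2)) = T / 2 * ‖(z₀ : X)‖ ^ 2 := by
    rw [← mul_assoc, e, one_mul]
  rw [h6] at hmul
  refine hmul.trans ((le_of_eq ?_).trans (add_le_add_left (add_le_add_left h5 _) _))
  linear_combination ((ψ Λ)⁻¹ * (∫ t in (0 : ℝ)..T, ‖D (a t)‖ ^ 2)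
    + Λ⁻¹ * (T / 2 * (⟪A z₀, (z₀ : X)⟫_ℂ).re)
    + (ε Λ)⁻¹ * (T / 2 * (κ ^ 2 * ‖(z₀ : X)‖ ^ 2))) * e

/-- Spectral coercivity gives the weak observation inequality: the cutoff frequency
`Λ = 4 (1 / T + λ)` and `T ≥ θ₁ / ε(Λ)` make each error term at most a quarter of the total. -/
theorem SpectrallyCoerciveWith.weakObservationInequality [CompleteSpace X] [CompleteSpace Y]
    (h : IsPositiveInverse A B m) (hB : IsCompactOperator B)
    (hD : ∀ z, C z = D (A z)) {ε ψ : ℝ → ℝ} (hε : IsDecreasingProfile ε)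
    (hψ : IsDecreasingProfile ψ) (hsc : SpectrallyCoerciveWith A C ε ψ) {E : ℝ} (hE : 0 < E)
    (hεE : ε 0 ≤ E) :
    WeakObservationInequality A C 4 (2 * Real.pi * √E) (2 * Real.pi * √E / (4 * E)) ε ψ := by
  intro z₀ z hz0 hz T₀ hT₀ T hTT
  set l := frequency A z₀ with hl
  have hl0 : 0 ≤ l := h.frequency_nonneg z₀
  have hT₀p := hT₀.1
  have hT : 0 < T := hT₀p.trans_le hTT
  set Λ := 4 * (1 / T + l) with hΛdef
  have hΛ : 0 < Λ := by positivity
  have hεΛ := hε.pos Λ hΛ.le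
  have hψΛ := hψ.pos Λ hΛ.le
  have hεΛE : ε Λ ≤ E := (hε.antitoneOn (mem_Ici.2 le_rfl) (mem_Ici.2 hΛ.le) hΛ.le).trans hεE
  have hθ : 2 * Real.pi * √E ≤ T * ε Λ := by
    rw [← hT₀.2]
    exact mul_le_mul hTT (profile_le_profile hε (by norm_num) hl0 le_rfl hT₀p hTT)
      (hε.pos _ (by positivity)).le hT.le
  have hpi := Real.pi_pos
  have hsqE : √E ^ 2 = E := Real.sq_sqrt hE.le
  have hn := IsPositiveInverse.norm_pos hz0
  have key := hsc.integral_le h hB hD hε hψ hΛ hz hT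
  have hq : (⟪A z₀, (z₀ : X)⟫_ℂ).re = l * ‖(z₀ : X)‖ ^ 2 := by
    rw [hl, frequency, div_mul_cancel₀ _ (by positivity)]
  rw [hq] at key
  set N := ‖(z₀ : X)‖ ^ 2 with hN
  have hNp : 0 < N := by positivity
  set J := ∫ t in (0 : ℝ)..T, ‖C (z t)‖ ^ 2 with hJ
  have e1 : Λ⁻¹ * (T / 2 * (l * N)) ≤ 1 / 4 * (T / 2 * N) := by
    have : Λ⁻¹ * l ≤ 1 / 4 := by
      rw [← div_eq_inv_mul, div_le_iff₀ hΛ, hΛdef]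
      have : 0 < 1 / T := by positivity
      linarith
    calc Λ⁻¹ * (T / 2 * (l * N)) = Λ⁻¹ * l * (T / 2 * N) := by ring
      _ ≤ _ := by gcongr
  have e2 : (ε Λ)⁻¹ * (T / 2 * ((Real.pi / T) ^ 2 * N)) ≤ 1 / 4 * (T / 2 * N) := by
    have : (ε Λ)⁻¹ * (Real.pi / T) ^ 2 ≤ 1 / 4 := by
      have h1 : (2 * Real.pi * √E) ^ 2 ≤ (T * ε Λ) ^ 2 := by gcongr
      rw [mul_pow, hsqE] at h1
      have h2 : (2 * Real.pi) ^ 2 ≤ T ^ 2 * ε Λ := by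
        by_contra! hlt
        nlinarith [mul_lt_mul_of_pos_right hlt hεΛ, mul_le_mul_of_nonneg_left hεΛE
          (sq_nonneg (2 * Real.pi))]
      rw [div_pow, ← div_eq_inv_mul, div_div, div_le_iff₀ (by positivity)]
      nlinarith
    calc (ε Λ)⁻¹ * (T / 2 * ((Real.pi / T) ^ 2 * N))
        = (ε Λ)⁻¹ * (Real.pi / T) ^ 2 * (T / 2 * N) := by ring
      _ ≤ _ := by gcongr
  have e3 : T / 4 * N ≤ (ψ Λ)⁻¹ * J := by linarith
  rw [← div_eq_inv_mul, le_div_iff₀ hψΛ] at e3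
  have e4 : 2 * Real.pi * √E / (4 * E) ≤ T / 4 := by
    rw [div_le_iff₀ (by positivity)]
    nlinarith
  calc 2 * Real.pi * √E / (4 * E) * ψ Λ * N ≤ T / 4 * ψ Λ * N := by gcongr
    _ = T / 4 * N * ψ Λ := by ring
    _ ≤ J := e3

end Observation

/-! ### Observability implies spectral coercivity -/

section Necessity

variable {X : Type*} [NormedAddCommGroup X] [InnerProductSpace ℂ X]
variable {Y : Type*} [NormedAddCommGroup Y] [InnerProductSpace ℂ Y]
variable {A : X →ₗ.[ℂ] X} {B : X →L[ℂ] X} {m : ℝ} {C : A.domain →ₗ[ℂ] Y} {D : X →L[ℂ] Y}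

theorem IsSolution.shift {z₀ : A.domain} {z : ℝ → A.domain} (hz : IsSolution A z₀ z) (s : ℝ) :
    IsSolution A (z s) (fun t => z (t + s)) :=
  ⟨by simp, fun t => (hz.2 (t + s)).comp_add_const t s⟩

/-- The admissibility constant grows at most linearly in time, because the group is unitary. -/
theorem IsAdmissible.exists_linear_bound [CompleteSpace X] (hadm : IsAdmissible A C)
    (h : IsPositiveInverse A B m) (hB : IsCompactOperator B) (hD : ∀ z, C z = D (A z)) :
    ∃ K : ℝ, 0 < K ∧ ∀ (z₀ : A.domain) (z : ℝ → A.domain), IsSolution A z₀ z → ∀ T : ℝ, 0 ≤ T →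
      ∫ t in (0 : ℝ)..T, ‖C (z t)‖ ^ 2 ≤ (T + 1) * K * ‖(z₀ : X)‖ ^ 2 := by
  obtain ⟨K, hK, hbound⟩ := hadm 1 one_pos
  refine ⟨K, hK, fun z₀ z hz T hT => ?_⟩
  have hc := (hz.continuous_observation h hB hD).norm.pow 2
  have hint (a b : ℝ) : IntervalIntegrable (fun t => ‖C (z t)‖ ^ 2) MeasureTheory.volume a b :=
    hc.intervalIntegrable a b
  have hnat (n : ℕ) : ∫ t in (0 : ℝ)..n, ‖C (z t)‖ ^ 2 ≤ n * K * ‖(z₀ : X)‖ ^ 2 := by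
    induction n with
    | zero => simp
    | succ n ih =>
      have h1 := hbound _ _ (hz.shift n)
      rw [hz.norm_eq h,
        intervalIntegral.integral_comp_add_right (fun t => ‖C (z t)‖ ^ 2)] at h1
      rw [← intervalIntegral.integral_add_adjacent_intervals (hint 0 n) (hint n _)]
      rw [zero_add, add_comm 1 (n : ℝ)] at h1
      push_cast
      linarith
  calc ∫ t in (0 : ℝ)..T, ‖C (z t)‖ ^ 2 ≤ ∫ t in (0 : ℝ)..⌈T⌉₊, ‖C (z t)‖ ^ 2 := by
        refine intervalIntegral.integral_mono_interval le_rfl hT (Nat.le_ceil T)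
          (.of_forall fun t => sq_nonneg _) (hint _ _)
    _ ≤ ⌈T⌉₊ * K * ‖(z₀ : X)‖ ^ 2 := hnat _
    _ ≤ (T + 1) * K * ‖(z₀ : X)‖ ^ 2 := by
        gcongr
        exact (Nat.ceil_lt_add_one hT).le

theorem integral_sq_le {f : ℝ → ℝ} (hf : Continuous f) {t : ℝ} (ht : 0 ≤ t) :
    (∫ s in (0 : ℝ)..t, f s) ^ 2 ≤ t * ∫ s in (0 : ℝ)..t, f s ^ 2 := by
  rcases ht.eq_or_lt with rfl | ht
  · simp
  set I := ∫ s in (0 : ℝ)..t, f s with hI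
  have h1 : 0 ≤ ∫ s in (0 : ℝ)..t, (f s - I / t) ^ 2 :=
    intervalIntegral.integral_nonneg ht.le fun s _ => sq_nonneg _
  have h2 : ∫ s in (0 : ℝ)..t, (f s - I / t) ^ 2
      = (∫ s in (0 : ℝ)..t, f s ^ 2) - 2 * (I / t) * I + t * (I / t) ^ 2 := by
    have h3 (s : ℝ) : (f s - I / t) ^ 2 = f s ^ 2 - 2 * (I / t) * f s + (I / t) ^ 2 := by ring
    simp only [h3]
    rw [intervalIntegral.integral_add, intervalIntegral.integral_sub,
      intervalIntegral.integral_const_mul, intervalIntegral.integral_const, sub_zero, smul_eq_mul]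
    all_goals exact Continuous.intervalIntegrable (by fun_prop) _ _
  rw [h2] at h1
  have h4 : t * ((∫ s in (0 : ℝ)..t, f s ^ 2) - 2 * (I / t) * I + t * (I / t) ^ 2)
      = t * (∫ s in (0 : ℝ)..t, f s ^ 2) - I ^ 2 := by
    field_simp
    ring
  have h5 := mul_nonneg ht.le h1
  rw [h4] at h5
  linarith

theorem norm_sub_sq_le_integral [CompleteSpace Y] {u u' : ℝ → Y}
    (hu : ∀ t, HasDerivAt u (u' t) t) (hu' : Continuous u') {t T : ℝ} (ht : 0 ≤ t) (htT : t ≤ T) :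
    ‖u t - u 0‖ ^ 2 ≤ T * ∫ s in (0 : ℝ)..T, ‖u' s‖ ^ 2 := by
  have h1 := intervalIntegral.integral_eq_sub_of_hasDerivAt (a := 0) (b := t)
    (fun s _ => hu s) (hu'.intervalIntegrable _ _)
  have h3 : ∫ s in (0 : ℝ)..t, ‖u' s‖ ^ 2 ≤ ∫ s in (0 : ℝ)..T, ‖u' s‖ ^ 2 :=
    intervalIntegral.integral_mono_interval le_rfl ht htT (.of_forall fun t => sq_nonneg _)
      ((hu'.norm.pow 2).intervalIntegrable _ _)
  calc ‖u t - u 0‖ ^ 2 ≤ (∫ s in (0 : ℝ)..t, ‖u' s‖) ^ 2 := by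
        rw [← h1]
        gcongr
        exact intervalIntegral.norm_integral_le_integral_norm ht
    _ ≤ t * ∫ s in (0 : ℝ)..t, ‖u' s‖ ^ 2 := integral_sq_le hu'.norm ht
    _ ≤ T * ∫ s in (0 : ℝ)..T, ‖u' s‖ ^ 2 := by
        have : 0 ≤ ∫ s in (0 : ℝ)..t, ‖u' s‖ ^ 2 :=
          intervalIntegral.integral_nonneg ht fun s _ => sq_nonneg _
        exact mul_le_mul htT h3 this (ht.trans htT)

theorem IsEntireSolution.isSolution {w : X} {F G : ℂ → X} (hF : IsEntireSolution B w F G)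
    (h : IsPositiveInverse A B m) : IsSolution A (h.lift w) (fun t : ℝ => h.lift (F t)) := by
  refine ⟨by simp [hF.init], fun t => ?_⟩
  have := (B.restrictScalars ℝ).hasFDerivAt.comp_hasDerivAt t (hF.hasDerivAt_real t)
  simp only [IsPositiveInverse.coe_lift, IsPositiveInverse.apply_lift]
  refine this.congr_deriv ?_
  rw [ContinuousLinearMap.coe_restrictScalars', map_smul, ← hF.eq_inv]

/-- For smooth data the observation deviates from that of the mode `exp (i l t) z₀` by at most
the defect `A z₀ - l z₀`: `exp (-i l t) C z(t) - C z₀` is the integral of the observation of the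
solution issued from this defect. -/
theorem IsEntireSolution.integral_observation_le [CompleteSpace X] [CompleteSpace Y]
    (h : IsPositiveInverse A B m)
    (hB : IsCompactOperator B) (hD : ∀ z, C z = D (A z)) {K : ℝ}
    (hK : ∀ (z₀ : A.domain) (z : ℝ → A.domain), IsSolution A z₀ z → ∀ T : ℝ, 0 ≤ T →
      ∫ t in (0 : ℝ)..T, ‖C (z t)‖ ^ 2 ≤ (T + 1) * K * ‖(z₀ : X)‖ ^ 2)
    {w : X} {F G : ℂ → X} (hF : IsEntireSolution B w F G) (l : ℝ) {T : ℝ} (hT : 0 ≤ T) :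
    ∫ t in (0 : ℝ)..T, ‖C (h.lift (F t))‖ ^ 2
      ≤ 2 * T * ‖D w‖ ^ 2 + 2 * T ^ 2 * (T + 1) * K * ‖w - (l : ℂ) • B w‖ ^ 2 := by
  have hzsol := hF.isSolution h
  -- the solution `f` issued from the defect
  have hfsol : IsSolution A (h.lift (G 0 - (l : ℂ) • F 0))
      (fun t : ℝ => h.lift (G t - (l : ℂ) • F t)) := by
    refine ⟨by simp, fun t => ?_⟩
    simp only [IsPositiveInverse.coe_lift, IsPositiveInverse.apply_lift, map_sub, map_smul,
      ← hF.eq_inv]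
    have h1 := (hF.hasDerivAt_real t).sub ((hzsol.2 t).const_smul (l : ℂ))
    simp only [IsPositiveInverse.coe_lift, IsPositiveInverse.apply_lift] at h1
    refine h1.congr_deriv ?_
    rw [smul_sub, smul_comm]
  have hfK := hK _ _ hfsol T hT
  have hf0 : (h.lift (G 0 - (l : ℂ) • F 0) : X) = w - (l : ℂ) • B w := by
    simp [← hF.eq_inv, hF.init]
  rw [hf0] at hfK
  have hfc := hfsol.continuous_observation h hB hD
  set e : ℝ → ℂ := fun t => Complex.exp (-(Complex.I * l * t)) with he
  have hec : Continuous e := by fun_prop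
  have hen (t : ℝ) : ‖e t‖ = 1 := by
    have h1 : -(Complex.I * l * t) = ((-(l * t) : ℝ) : ℂ) * Complex.I := by
      push_cast
      ring
    simp only [he, h1, Complex.norm_exp_ofReal_mul_I]
  have hu (t : ℝ) : HasDerivAt (fun t : ℝ => e t • D (F t))
      (e t • Complex.I • C (h.lift (G t - (l : ℂ) • F t))) t := by
    have h1 : HasDerivAt e (e t * -(Complex.I * l)) t := by
      have h3 : HasDerivAt (fun s : ℝ => -(Complex.I * l * (s : ℂ))) (-(Complex.I * l)) t := by
        simpa using ((hasDerivAt_id t).ofReal_comp.const_mul (Complex.I * (l : ℂ))).fun_neg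
      exact h3.cexp
    have h2 := (D.restrictScalars ℝ).hasFDerivAt.comp_hasDerivAt t (hF.hasDerivAt_real t)
    refine (h1.smul h2).congr_deriv ?_
    simp only [ContinuousLinearMap.coe_restrictScalars', Function.comp_apply, hD, map_smul,
      IsPositiveInverse.apply_lift, map_sub, smul_sub, smul_smul]
    rw [mul_neg, neg_smul, ← sub_eq_add_neg]
  have hbound (t : ℝ) (ht : t ∈ Icc 0 T) : ‖C (h.lift (F t))‖ ^ 2
      ≤ 2 * ‖D w‖ ^ 2 + 2 * (T * ((T + 1) * K * ‖w - (l : ℂ) • B w‖ ^ 2)) := by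
    have h1 := norm_sub_sq_le_integral hu (hec.smul (hfc.const_smul Complex.I)) ht.1 ht.2
    have e0 : e 0 = 1 := by simp [he]
    simp only [norm_smul, hen, Complex.norm_I, one_mul, e0, one_smul, Complex.ofReal_zero,
      hF.init] at h1
    have h2 := h1.trans (mul_le_mul_of_nonneg_left hfK hT)
    have h3 : ‖C (h.lift (F t))‖ = ‖e t • D (F t)‖ := by
      rw [norm_smul, hen, one_mul, hD, h.apply_lift]
    have h4 : ‖e t • D (F t)‖ ≤ ‖D w‖ + ‖e t • D (F t) - D w‖ := by
      simpa using norm_add_le (D w) (e t • D (F t) - D w)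
    rw [h3]
    nlinarith [norm_nonneg (e t • D (F t)), sq_nonneg (‖D w‖ - ‖e t • D (F t) - D w‖)]
  have hmono := intervalIntegral.integral_mono_on hT
    (((hzsol.continuous_observation h hB hD).norm.pow 2).intervalIntegrable 0 T)
    (intervalIntegrable_const (μ := MeasureTheory.volume)) hbound
  refine hmono.trans (le_of_eq ?_)
  rw [intervalIntegral.integral_const, sub_zero, smul_eq_mul]
  ring

/-- Observability on a time interval depending on the frequency implies spectral coercivity. -/
theorem spectrallyCoercive_of_observation [CompleteSpace X] [CompleteSpace Y]
    (h : IsPositiveInverse A B m) (hB : IsCompactOperator B) (hD : ∀ z, C z = D (A z))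
    (hadm : IsAdmissible A C) {φ τ : ℝ → ℝ} (hφ : IsDecreasingProfile φ)
    (hτc : ContinuousOn τ (Ici 0)) (hτm : MonotoneOn τ (Ici 0)) (hτp : ∀ l, 0 ≤ l → 0 < τ l)
    (hobs : ∀ (z₀ : A.domain) (z : ℝ → A.domain), z₀ ≠ 0 → IsSolution A z₀ z →
      φ (frequency A z₀) * ‖(z₀ : X)‖ ^ 2
        ≤ ∫ t in (0 : ℝ)..τ (frequency A z₀), ‖C (z t)‖ ^ 2) :
    SpectrallyCoercive A C := by
  obtain ⟨K, hKp, hK⟩ := hadm.exists_linear_bound h hB hD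
  -- the frequency as a function of `w = A z`
  set f : X → ℝ := fun w => (⟪w, B w⟫_ℂ).re / ‖B w‖ ^ 2 with hf
  have hf0 (w : X) : 0 ≤ f w := div_nonneg (h.inner_inv_nonneg w) (sq_nonneg _)
  set R : X → ℝ := fun w => 2 * τ (f w) * ‖D w‖ ^ 2
    + 2 * τ (f w) ^ 2 * (τ (f w) + 1) * K * ‖w - (f w : ℂ) • B w‖ ^ 2 with hR
  have hsmooth (w : X) (hw : w ∈ eigenSum B) (hBw : B w ≠ 0) : φ (f w) * ‖B w‖ ^ 2 ≤ R w := by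
    obtain ⟨F, G, hF⟩ := h.exists_isEntireSolution hw
    have hz0 : h.lift w ≠ 0 := fun h0 => hBw (by rw [← h.coe_lift, h0]; rfl)
    have h1 := hobs _ _ hz0 (hF.isSolution h)
    rw [h.frequency_lift, h.coe_lift] at h1
    exact h1.trans (hF.integral_observation_le h hB hD hK (f w) (hτp _ (hf0 w)).le)
  -- by density the estimate holds for all data
  have hall (w : X) (hBw : B w ≠ 0) : φ (f w) * ‖B w‖ ^ 2 ≤ R w := by
    obtain ⟨v, hv, hvw⟩ := mem_closure_iff_seq_limit.1 (h.dense_eigenSum hB w)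
    have hB1 : Tendsto (fun n => B (v n)) atTop (𝓝 (B w)) := (B.continuous.tendsto w).comp hvw
    have hD1 : Tendsto (fun n => D (v n)) atTop (𝓝 (D w)) := (D.continuous.tendsto w).comp hvw
    have hf1 : Tendsto (fun n => f (v n)) atTop (𝓝 (f w)) := by
      refine Tendsto.div ((Complex.continuous_re.tendsto _).comp (hvw.inner hB1))
        (hB1.norm.pow 2) ?_
      have := norm_pos_iff.2 hBw
      positivity
    have hf2 : Tendsto (fun n => f (v n)) atTop (𝓝[Ici 0] (f w)) :=
      tendsto_nhdsWithin_iff.2 ⟨hf1, .of_forall fun n => hf0 _⟩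
    have hφ1 : Tendsto (fun n => φ (f (v n))) atTop (𝓝 (φ (f w))) :=
      (hφ.continuousOn (f w) (hf0 w)).tendsto.comp hf2
    have hτ1 : Tendsto (fun n => τ (f (v n))) atTop (𝓝 (τ (f w))) :=
      (hτc (f w) (hf0 w)).tendsto.comp hf2
    have hR1 : Tendsto (fun n => R (v n)) atTop (𝓝 (R w)) := by
      have hfc : Tendsto (fun n => (f (v n) : ℂ)) atTop (𝓝 (f w : ℂ)) :=
        (Complex.continuous_ofReal.tendsto _).comp hf1
      exact ((hτ1.const_mul 2).mul (hD1.norm.pow 2)).add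
        (((((hτ1.pow 2).const_mul 2).mul (hτ1.add_const 1)).mul_const K).mul
          ((hvw.sub (hfc.smul hB1)).norm.pow 2))
    refine le_of_tendsto_of_tendsto (hφ1.mul (hB1.norm.pow 2)) hR1 ?_
    filter_upwards [hB1.eventually_ne hBw] with n hn
    exact hsmooth (v n) (hv n) hn
  have hτi := IsDecreasingProfile.inv hτc hτm hτp
  have hτ1i : IsDecreasingProfile fun l => (τ l + 1)⁻¹ :=
    IsDecreasingProfile.inv (hτc.add continuousOn_const)
      (fun x hx y hy hxy => by linarith [hτm hx hy hxy]) (fun x hx => by linarith [hτp x hx])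
  refine ⟨fun l => φ l * (τ l)⁻¹ * (τ l)⁻¹ * (τ l + 1)⁻¹ * (4 * K)⁻¹,
    fun l => φ l * (τ l)⁻¹ * 4⁻¹,
    (((hφ.mul hτi).mul hτi).mul hτ1i).mul (.const (by positivity)),
    (hφ.mul hτi).mul (.const (by norm_num)), fun z hz hlt => ?_⟩
  have hn := IsPositiveInverse.norm_pos hz
  have h1 := hall (A z) (by rw [h.left_inv]; exact norm_pos_iff.1 hn)
  have hfz : f (A z) = frequency A z := by simp only [hf, h.left_inv, frequency]
  have hl0 := h.frequency_nonneg z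
  simp only [hR, hfz, h.left_inv] at h1
  set l := frequency A z with hl
  have hT := hτp l hl0
  set T := τ l
  have hdef := IsPositiveInverse.norm_sub_smul_sq z l
  have hq : (⟪A z, (z : X)⟫_ℂ).re = l * ‖(z : X)‖ ^ 2 := by
    rw [hl, frequency, div_mul_cancel₀ _ (by positivity)]
  rw [hq] at hdef
  rw [sub_lt_iff_lt_add, div_lt_iff₀ (by positivity)] at hlt
  set N := ‖(z : X)‖ ^ 2
  have h2 : ‖A z - (l : ℂ) • (z : X)‖ ^ 2 ≤ φ l * T⁻¹ * T⁻¹ * (T + 1)⁻¹ * (4 * K)⁻¹ * N := by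
    rw [hdef]
    linarith
  have h3 : 2 * T ^ 2 * (T + 1) * K * ‖A z - (l : ℂ) • (z : X)‖ ^ 2 ≤ φ l * N / 2 := by
    calc _ ≤ 2 * T ^ 2 * (T + 1) * K * (φ l * T⁻¹ * T⁻¹ * (T + 1)⁻¹ * (4 * K)⁻¹ * N) := by gcongr
      _ = φ l * N / 2 := by
        have : T + 1 ≠ 0 := by positivity
        field_simp
        ring
  rw [← hD] at h1
  have h4 : φ l * N / 2 ≤ 2 * T * ‖C z‖ ^ 2 := by linarith
  calc φ l * T⁻¹ * 4⁻¹ * N = (φ l * N / 2) / (2 * T) := by field_simp; ring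
    _ ≤ 2 * T * ‖C z‖ ^ 2 / (2 * T) := by gcongr
    _ = ‖C z‖ ^ 2 := by field_simp

theorem WeaklyObservableIn.spectrallyCoercive [CompleteSpace X] [CompleteSpace Y]
    (h : IsPositiveInverse A B m) (hB : IsCompactOperator B) (hD : ∀ z, C z = D (A z))
    (hadm : IsAdmissible A C) {T : ℝ} (hT : 0 < T) (hobs : WeaklyObservableIn A C T) :
    SpectrallyCoercive A C := by
  obtain ⟨φ, hφ, hobs⟩ := hobs
  exact spectrallyCoercive_of_observation h hB hD hadm hφ (τ := fun _ => T) continuousOn_const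
    (fun _ _ _ _ _ => le_rfl) (fun _ _ => hT) hobs

/-- The observation time `T(l)` is replaced by the explicit upper bound
`θ₁ / ε(θ₀ (1 / T(0) + l))`, which is continuous and increasing in `l`. -/
theorem WeakObservationInequality.spectrallyCoercive [CompleteSpace X] [CompleteSpace Y]
    (h : IsPositiveInverse A B m) (hB : IsCompactOperator B) (hD : ∀ z, C z = D (A z))
    (hadm : IsAdmissible A C) {θ₀ θ₁ θ₂ : ℝ} (hθ₀ : 0 < θ₀) (hθ₁ : 0 < θ₁) (hθ₂ : 0 < θ₂)
    {ε ψ : ℝ → ℝ} (hε : IsDecreasingProfile ε) (hψ : IsDecreasingProfile ψ)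
    (hobs : WeakObservationInequality A C θ₀ θ₁ θ₂ ε ψ) : SpectrallyCoercive A C := by
  obtain ⟨S, hS⟩ := exists_isObservationTime hε hθ₀ hθ₁ le_rfl
  have hSp := hS.1
  have hεS := hε.comp_affine (b := 1 / S) hθ₀.le (by positivity)
  have hψS := hψ.comp_affine (b := 1 / S) hθ₀.le (by positivity)
  have hτ := fun l hl => div_pos hθ₁ (hεS.pos l hl)
  refine spectrallyCoercive_of_observation h hB hD hadm ((IsDecreasingProfile.const hθ₂).mul hψS)
    (τ := fun l => θ₁ / ε (θ₀ * (1 / S + l)))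
    (continuousOn_const.div hεS.continuousOn fun l hl => (hεS.pos l hl).ne')
    (fun x hx y hy hxy => div_le_div_of_nonneg_left hθ₁.le (hεS.pos y hy)
      (hεS.antitoneOn hx hy hxy)) hτ fun z₀ z hz0 hz => ?_
  have hl0 := h.frequency_nonneg z₀
  set l := frequency A z₀
  obtain ⟨T₀, hT₀⟩ := exists_isObservationTime hε hθ₀ hθ₁ hl0
  have hT₀p := hT₀.1
  have hST : S ≤ T₀ := isObservationTime_mono hε hθ₀ le_rfl hl0 hS hT₀
  have hTτ : T₀ ≤ θ₁ / ε (θ₀ * (1 / S + l)) := by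
    rw [le_div_iff₀ (hεS.pos l hl0), ← hT₀.2]
    exact mul_le_mul_of_nonneg_left (profile_le_profile hε hθ₀ hl0 le_rfl hSp hST) hT₀p.le
  refine le_trans ?_ (hobs z₀ z hz0 hz T₀ hT₀ _ hTτ)
  gcongr
  exact profile_le_profile hψ hθ₀ hl0 le_rfl hSp (hST.trans hTτ)

end Necessity

/-! ### Unique continuation from a real interval -/

section UniqueContinuation

variable {f : ℂ → ℂ} {T : ℝ}

/-- The product of the four rotations of `f` about the centre of a square vanishes on the whole
boundary of the square as soon as `f` vanishes on its bottom side. -/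
theorem eq_zero_of_eq_zero_on_side {c : ℂ} {b : ℝ} (hb : 0 < b)
    (hfc : ContinuousOn f (Icc (c.re - b) (c.re + b) ×ℂ Icc (c.im - b) (c.im + b)))
    (hfd : DifferentiableOn ℂ f (Ioo (c.re - b) (c.re + b) ×ℂ Ioo (c.im - b) (c.im + b)))
    (h0 : ∀ ζ : ℂ, ζ.re ∈ Icc (c.re - b) (c.re + b) → ζ.im = c.im - b → f ζ = 0) :
    f c = 0 := by
  set Q : Set ℂ := Ioo (-b) b ×ℂ Ioo (-b) b with hQ
  have hclos : closure Q = Icc (-b) b ×ℂ Icc (-b) b := by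
    rw [hQ, Complex.closure_reProdIm, closure_Ioo (by linarith)]
  have hQb : Bornology.IsBounded Q :=
    (Metric.isBounded_Ioo _ _).reProdIm (Metric.isBounded_Ioo _ _)
  have hQo : IsOpen Q := isOpen_Ioo.reProdIm isOpen_Ioo
  -- multiplication by a fourth root of unity preserves the square
  have hd (r : ℂ) (hr : ∀ ξ, |(r * ξ).re| = |ξ.re| ∧ |(r * ξ).im| = |ξ.im| ∨
      |(r * ξ).re| = |ξ.im| ∧ |(r * ξ).im| = |ξ.re|) :
      DiffContOnCl ℂ (fun ξ => f (c + r * ξ)) Q := by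
    refine ⟨hfd.comp (by fun_prop) fun ξ hξ => ?_, hfc.comp (by fun_prop) fun ξ hξ => ?_⟩
    · have h1 : |ξ.re| < b ∧ |ξ.im| < b := ⟨abs_lt.2 hξ.1, abs_lt.2 hξ.2⟩
      have h2 : |(r * ξ).re| < b ∧ |(r * ξ).im| < b := by
        rcases hr ξ with h | h <;> rw [h.1, h.2] <;> tauto
      rw [abs_lt, abs_lt] at h2
      simp only [Complex.mem_reProdIm, mem_Ioo, Complex.add_re, Complex.add_im]
      exact ⟨⟨by linarith, by linarith⟩, by linarith, by linarith⟩
    · rw [hclos] at hξ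
      have h1 : |ξ.re| ≤ b ∧ |ξ.im| ≤ b := ⟨abs_le.2 hξ.1, abs_le.2 hξ.2⟩
      have h2 : |(r * ξ).re| ≤ b ∧ |(r * ξ).im| ≤ b := by
        rcases hr ξ with h | h <;> rw [h.1, h.2] <;> tauto
      rw [abs_le, abs_le] at h2
      simp only [Complex.mem_reProdIm, mem_Icc, Complex.add_re, Complex.add_im]
      exact ⟨⟨by linarith, by linarith⟩, by linarith, by linarith⟩
  have key {a : ℂ → ℂ} (ha : a = fun ξ => f (c + 1 * ξ) * f (c + Complex.I * ξ)
      * f (c + (-1) * ξ) * f (c + (-Complex.I) * ξ)) : ‖a 0‖ ≤ 0 := by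
    have h1 := hd 1 (by simp)
    have h2 := hd Complex.I (by simp)
    have h3 := hd (-1) (by simp)
    have h4 := hd (-Complex.I) (by simp)
    rw [ha]
    refine Complex.norm_le_of_forall_mem_frontier_norm_le hQb
      (⟨((h1.1.mul h2.1).mul h3.1).mul h4.1, ((h1.2.mul h2.2).mul h3.2).mul h4.2⟩) ?_
      (subset_closure (by simp [hQ, Complex.mem_reProdIm, hb]))
    intro ξ hξ
    rw [hQo.frontier_eq, hclos] at hξ
    obtain ⟨⟨⟨hr1, hr2⟩, hi1, hi2⟩, hnot⟩ := hξ
    have hnot' : ξ.im = -b ∨ ξ.im = b ∨ ξ.re = -b ∨ ξ.re = b := by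
      by_contra! hcon
      exact hnot ⟨⟨lt_of_le_of_ne hr1 (Ne.symm hcon.2.2.1), lt_of_le_of_ne hr2 hcon.2.2.2⟩,
        lt_of_le_of_ne hi1 (Ne.symm hcon.1), lt_of_le_of_ne hi2 hcon.2.1⟩
    have hz (r : ℂ) (hre : |(r * ξ).re| ≤ b) (him : (r * ξ).im = -b) : f (c + r * ξ) = 0 := by
      rw [abs_le] at hre
      refine h0 _ ?_ ?_
      · rw [Complex.add_re]
        exact ⟨by linarith, by linarith⟩
      · rw [Complex.add_im, him]
        ring
    have hre : |ξ.re| ≤ b := abs_le.2 ⟨hr1, hr2⟩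
    have him : |ξ.im| ≤ b := abs_le.2 ⟨hi1, hi2⟩
    have hprod : f (c + 1 * ξ) = 0 ∨ f (c + Complex.I * ξ) = 0 ∨ f (c + (-1) * ξ) = 0 ∨
        f (c + (-Complex.I) * ξ) = 0 := by
      rcases hnot' with h | h | h | h
      · exact .inl (hz 1 (by simpa using hre) (by simpa using h))
      · exact .inr (.inr (.inl (hz (-1) (by simpa using hre) (by simpa using h))))
      · exact .inr (.inl (hz Complex.I (by simpa using him) (by simpa using h)))
      · exact .inr (.inr (.inr (hz (-Complex.I) (by simpa using him) (by simpa using h))))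
    simp only [norm_le_zero_iff, Pi.mul_apply, mul_eq_zero]
    tauto
  have h := key rfl
  simp only [mul_zero, add_zero, norm_le_zero_iff, mul_eq_zero, or_self] at h
  exact h

theorem eq_zero_of_eq_zero_on_interval (hT : 0 < T) (hfc : ContinuousOn f {ζ | 0 ≤ ζ.im})
    (hfd : DifferentiableOn ℂ f {ζ | 0 < ζ.im}) (h0 : ∀ t ∈ Icc 0 T, f (t : ℂ) = 0) {ζ : ℂ}
    (hζ : 0 ≤ ζ.im) : f ζ = 0 := by
  have hopen : IsOpen {ζ : ℂ | 0 < ζ.im} := isOpen_lt continuous_const Complex.continuous_im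
  -- `f` vanishes at the centre of every square in the half-plane with bottom side in `[0, T]`
  have hsq (c : ℂ) (hc : 0 < c.im) (h1 : 0 ≤ c.re - c.im) (h2 : c.re + c.im ≤ T) : f c = 0 := by
    refine eq_zero_of_eq_zero_on_side hc (hfc.mono fun ξ hξ => ?_) (hfd.mono fun ξ hξ => ?_)
      fun ξ hre him => ?_
    · have := hξ.2.1
      simpa using this
    · have := hξ.2.1
      simpa using this
    · have : ξ = (ξ.re : ℂ) := Complex.ext rfl (by simp [him])
      rw [this]
      exact h0 _ ⟨by linarith [hre.1], by linarith [hre.2]⟩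
  have hzero : EqOn f 0 {ζ | 0 < ζ.im} := by
    refine (hfd.analyticOnNhd hopen).eqOn_zero_of_preconnected_of_eventuallyEq_zero
      (convex_halfSpace_im_gt 0).isPreconnected
      (z₀ := ⟨T / 2, T / 4⟩) (by change 0 < T / 4; positivity) ?_
    have e1 : ∀ᶠ c : ℂ in 𝓝 ⟨T / 2, T / 4⟩, 0 < c.im :=
      hopen.mem_nhds (by change 0 < T / 4; positivity)
    have e2 : ∀ᶠ c : ℂ in 𝓝 ⟨T / 2, T / 4⟩, 0 < c.re - c.im :=
      (isOpen_lt continuous_const (Complex.continuous_re.sub Complex.continuous_im)).mem_nhds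
        (by change 0 < T / 2 - T / 4; linarith)
    have e3 : ∀ᶠ c : ℂ in 𝓝 ⟨T / 2, T / 4⟩, c.re + c.im < T :=
      (isOpen_lt (Complex.continuous_re.add Complex.continuous_im) continuous_const).mem_nhds
        (by change T / 2 + T / 4 < T; linarith)
    filter_upwards [e1, e2, e3] with c h1 h2 h3
    exact hsq c h1 h2.le h3.le
  refine hzero.of_subset_closure hfc continuousOn_const (fun ξ (hξ : 0 < ξ.im) => hξ.le) ?_ hζ
  rw [Complex.closure_setOfPred_lt_im]

end UniqueContinuation

/-! ### Spectral coercivity implies weak observability in every time -/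

section Sufficiency

variable {X : Type*} [NormedAddCommGroup X] [InnerProductSpace ℂ X]
variable {Y : Type*} [NormedAddCommGroup Y] [InnerProductSpace ℂ Y]
variable {A : X →ₗ.[ℂ] X} {B : X →L[ℂ] X} {m : ℝ} {C : A.domain →ₗ[ℂ] Y} {D : X →L[ℂ] Y}

/-- An observation which is constant on some time interval vanishes for all times: by unique
continuation it is constant in the upper half-plane, where it decays. -/
theorem IsFlow.observation_eq_zero (hm : 0 < m) {w : X} {F : ℂ → X} (hF : IsFlow B m w F)
    {T : ℝ} (hT : 0 < T) (hconst : ∀ t ∈ Icc 0 T, D (F (t : ℂ)) = D w) (t : ℝ) :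
    D (F t) = 0 := by
  refine ext_inner_left ℂ fun y => ?_
  have hvan {ζ : ℂ} (hζ : 0 ≤ ζ.im) : ⟪y, D (F ζ)⟫_ℂ = ⟪y, D w⟫_ℂ := by
    have hL : Continuous fun v => ⟪y, D v⟫_ℂ := by fun_prop
    have := eq_zero_of_eq_zero_on_interval (f := fun ζ => ⟪y, D (F ζ)⟫_ℂ - ⟪y, D w⟫_ℂ) hT
      ((hL.comp_continuousOn hF.continuousOn).sub continuousOn_const)
      (((innerSL ℂ y ∘L D).differentiable.comp_differentiableOn hF.differentiableOn).sub
        (differentiableOn_const _))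
      (fun t ht => by rw [hconst t ht, sub_self]) hζ
    exact sub_eq_zero.1 this
  have hlim : Tendsto (fun s : ℝ => ‖y‖ * (‖D‖ * (Real.exp (-m * s) * ‖w‖))) atTop (𝓝 0) := by
    have h1 : Tendsto (fun s : ℝ => Real.exp (-m * s)) atTop (𝓝 0) :=
      Real.tendsto_exp_atBot.comp
        (tendsto_id.const_mul_atTop_of_neg (neg_lt_zero.2 hm))
    simpa using ((h1.mul_const ‖w‖).const_mul ‖D‖).const_mul ‖y‖
  have hle : ‖⟪y, D w⟫_ℂ‖ ≤ 0 := by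
    refine ge_of_tendsto hlim ?_
    filter_upwards [eventually_ge_atTop 0] with s hs
    have him : (Complex.I * s).im = s := by simp
    rw [← hvan (ζ := Complex.I * s) (by rw [him]; exact hs)]
    refine (norm_inner_le_norm _ _).trans ?_
    gcongr
    refine (D.le_opNorm _).trans ?_
    gcongr
    have := hF.norm_le (Complex.I * s) (by rw [him]; exact hs)
    rwa [him] at this
  rw [hvan (by simp), norm_le_zero_iff.1 hle, inner_zero_right]

theorem IsSolution.sub {z₀ z₀' : A.domain} {z z' : ℝ → A.domain} (hz : IsSolution A z₀ z)
    (hz' : IsSolution A z₀' z') : IsSolution A (z₀ - z₀') (fun t => z t - z' t) := by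
  refine ⟨congrArg₂ (· - ·) hz.1 hz'.1, fun t => ?_⟩
  rw [A.map_sub, smul_sub]
  exact (hz.2 t).sub (hz'.2 t)

theorem IsSolution.const_smul {z₀ : A.domain} {z : ℝ → A.domain} (hz : IsSolution A z₀ z)
    (c : ℂ) : IsSolution A (c • z₀) (fun t => c • z t) := by
  refine ⟨congrArg (c • ·) hz.1, fun t => ?_⟩
  rw [A.map_smul, smul_comm]
  exact (hz.2 t).const_smul c

/-- Applying `B = A⁻¹` to a solution gives a solution. -/
theorem IsSolution.lift {z₀ : A.domain} {z : ℝ → A.domain} (hz : IsSolution A z₀ z)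
    (h : IsPositiveInverse A B m) : IsSolution A (h.lift z₀) (fun t => h.lift (z t)) := by
  refine ⟨congrArg (fun v : A.domain => h.lift (v : X)) hz.1, fun t => ?_⟩
  have := (B.restrictScalars ℝ).hasFDerivAt.comp_hasDerivAt t (hz.2 t)
  simp only [IsPositiveInverse.coe_lift, IsPositiveInverse.apply_lift]
  refine this.congr_deriv ?_
  rw [ContinuousLinearMap.coe_restrictScalars', map_smul, h.left_inv]

/-- Interpolation between the energy space and its dual, from the positivity of the form of `A`
at `u - s A⁻¹ u`. -/
theorem IsPositiveInverse.two_mul_norm_sq_le (h : IsPositiveInverse A B m) (u : A.domain)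
    (s : ℝ) :
    2 * s * ‖(u : X)‖ ^ 2
      ≤ (⟪A u, (u : X)⟫_ℂ).re + s ^ 2 * (⟪(u : X), B (u : X)⟫_ℂ).re := by
  set v : A.domain := u - (s : ℂ) • h.lift (u : X) with hv
  have h1 : 0 ≤ (⟪A v, (v : X)⟫_ℂ).re :=
    (mul_nonneg h.bound_pos.le (sq_nonneg _)).trans (h.bound_le v)
  have h2 : A v = A u - (s : ℂ) • (u : X) := by
    rw [hv, A.map_sub, A.map_smul, h.apply_lift]
  have h3 : (v : X) = u - (s : ℂ) • B u := by simp [hv]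
  have h4 : (⟪A u, B (u : X)⟫_ℂ).re = ‖(u : X)‖ ^ 2 := by
    rw [← h.symm_inv, h.left_inv]
    exact inner_self_eq_norm_sq (𝕜 := ℂ) _
  have h5 : (⟪(u : X), (u : X)⟫_ℂ).re = ‖(u : X)‖ ^ 2 := inner_self_eq_norm_sq (𝕜 := ℂ) _
  rw [h2, h3] at h1
  simp only [inner_sub_left, inner_sub_right, inner_smul_left, inner_smul_right,
    Complex.conj_ofReal, Complex.sub_re, Complex.re_ofReal_mul, h4, h5] at h1
  nlinarith

/-- Vectors of bounded energy form a relatively compact set. -/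
theorem IsPositiveInverse.exists_tendsto_subseq [CompleteSpace X] (h : IsPositiveInverse A B m)
    (hB : IsCompactOperator B) {Λ : ℝ} (z : ℕ → A.domain) (hz1 : ∀ n, ‖(z n : X)‖ = 1)
    (hzΛ : ∀ n, (⟪A (z n), (z n : X)⟫_ℂ).re ≤ Λ) :
    ∃ (x : X) (φ : ℕ → ℕ), StrictMono φ ∧ Tendsto (fun n => (z (φ n) : X)) atTop (𝓝 x) := by
  obtain ⟨K, hK, hBK⟩ := hB.image_closedBall_subset_compact 1
  obtain ⟨y, _, φ, hφ, hy⟩ := hK.tendsto_subseq (x := fun n => B (z n))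
    (fun n => hBK ⟨z n, by simp [hz1], rfl⟩)
  have hnn (v : A.domain) : 0 ≤ (⟪A v, (v : X)⟫_ℂ).re :=
    (mul_nonneg h.bound_pos.le (sq_nonneg _)).trans (h.bound_le v)
  have hΛ : 0 ≤ Λ := (hnn (z 0)).trans (hzΛ 0)
  suffices hc : CauchySeq fun n => (z (φ n) : X) by
    obtain ⟨x, hx⟩ := cauchySeq_tendsto_of_complete hc
    exact ⟨x, φ, hφ, hx⟩
  refine Metric.cauchySeq_iff.2 fun ε hε => ?_
  set s := 4 * Λ / ε ^ 2 + 1 with hs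
  have hsp : 0 < s := by positivity
  obtain ⟨N, hN⟩ := Metric.cauchySeq_iff.1 hy.cauchySeq (ε ^ 2 / (2 * s)) (by positivity)
  refine ⟨N, fun a ha b hb => ?_⟩
  have hab := hN a ha b hb
  simp only [Function.comp_apply] at hab
  rw [dist_eq_norm, ← map_sub] at hab
  rw [dist_eq_norm]
  set u : A.domain := z (φ a) - z (φ b) with hu
  have hucoe : (u : X) = z (φ a) - z (φ b) := rfl
  rw [← hucoe] at hab ⊢
  have hun : ‖(u : X)‖ ≤ 2 := by
    rw [hucoe]
    refine (norm_sub_le _ _).trans ?_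
    rw [hz1, hz1]
    norm_num
  have hq : (⟪A u, (u : X)⟫_ℂ).re ≤ 4 * Λ := by
    have h1 := hnn (z (φ a) + z (φ b))
    have h2 : (⟪A u, (u : X)⟫_ℂ).re
          + (⟪A (z (φ a) + z (φ b)), ((z (φ a) + z (φ b) : A.domain) : X)⟫_ℂ).re
        = 2 * (⟪A (z (φ a)), (z (φ a) : X)⟫_ℂ).re + 2 * (⟪A (z (φ b)), (z (φ b) : X)⟫_ℂ).re := by
      rw [hu, A.map_sub, A.map_add]
      simp only [Submodule.coe_sub, Submodule.coe_add, inner_sub_left, inner_sub_right,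
        inner_add_left, inner_add_right, Complex.sub_re, Complex.add_re]
      ring
    linarith [hzΛ (φ a), hzΛ (φ b)]
  have hp : (⟪(u : X), B (u : X)⟫_ℂ).re ≤ 2 * ‖B (u : X)‖ :=
    (Complex.re_le_norm _).trans ((norm_inner_le_norm _ _).trans (by gcongr))
  have hform := h.two_mul_norm_sq_le u s
  have hs2 : s * ε ^ 2 = 4 * Λ + ε ^ 2 := by
    rw [hs]
    field_simp
  rw [lt_div_iff₀ (by positivity)] at hab
  have hlt : 2 * s * ‖(u : X)‖ ^ 2 < 2 * s * ε ^ 2 := by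
    have : s ^ 2 * (⟪(u : X), B (u : X)⟫_ℂ).re ≤ s * (‖B (u : X)‖ * (2 * s)) := by
      nlinarith [sq_nonneg s]
    have h6 := mul_lt_mul_of_pos_left hab hsp
    have := sq_nonneg ε
    nlinarith [sq_pos_of_pos hε]
  have hlt2 := lt_of_mul_lt_mul_left hlt (by positivity)
  exact lt_of_pow_lt_pow_left₀ 2 hε.le hlt2

/-- Compactness and unique continuation give observability on bounded frequencies. -/
theorem SpectrallyCoercive.exists_bound [CompleteSpace X] [CompleteSpace Y]
    (h : IsPositiveInverse A B m) (hB : IsCompactOperator B) (hD : ∀ z, C z = D (A z))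
    (hsc : SpectrallyCoercive A C) {T : ℝ} (hT : 0 < T) (Λ : ℝ) :
    ∃ δ : ℝ, 0 < δ ∧ ∀ (z₀ : A.domain) (z : ℝ → A.domain), z₀ ≠ 0 → frequency A z₀ ≤ Λ →
      IsSolution A z₀ z → δ * ‖(z₀ : X)‖ ^ 2 ≤ ∫ t in (0 : ℝ)..T, ‖C (z t)‖ ^ 2 := by
  by_contra! hcon
  choose v u hv0 hvΛ hvu hlt using fun n : ℕ => hcon (1 / ((n : ℝ) + 1)) (by positivity)
  -- normalized initial data `x n` with solutions `y n`
  set c : ℕ → ℂ := fun n => ((‖(v n : X)‖⁻¹ : ℝ) : ℂ) with hc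
  have hcn (n : ℕ) : ‖c n‖ = ‖(v n : X)‖⁻¹ := by simp [hc]
  set x : ℕ → A.domain := fun n => c n • v n with hx
  set y : ℕ → ℝ → A.domain := fun n t => c n • u n t with hy
  have hxy (n : ℕ) : IsSolution A (x n) (y n) := (hvu n).const_smul (c n)
  have hx1 (n : ℕ) : ‖(x n : X)‖ = 1 := by
    have := IsPositiveInverse.norm_pos (hv0 n)
    simp only [hx, Submodule.coe_smul]
    rw [norm_smul, hcn, inv_mul_cancel₀ this.ne']
  have hxΛ (n : ℕ) : (⟪A (x n), (x n : X)⟫_ℂ).re ≤ Λ := by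
    have h1 : (⟪A (x n), (x n : X)⟫_ℂ).re = frequency A (v n) := by
      simp only [hx, hc, A.map_smul, Submodule.coe_smul, inner_smul_left, inner_smul_right,
        Complex.conj_ofReal, Complex.re_ofReal_mul, frequency]
      rw [div_eq_inv_mul, sq, mul_inv, mul_assoc]
    exact h1.trans_le (hvΛ n)
  have hyint (n : ℕ) : ∫ t in (0 : ℝ)..T, ‖C (y n t)‖ ^ 2 ≤ 1 / ((n : ℝ) + 1) := by
    have h1 (t : ℝ) : ‖C (y n t)‖ ^ 2 = (‖(v n : X)‖ ^ 2)⁻¹ * ‖C (u n t)‖ ^ 2 := by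
      simp only [hy, map_smul]
      rw [norm_smul, hcn, mul_pow, inv_pow]
    have := IsPositiveInverse.norm_pos (hv0 n)
    simp only [h1]
    rw [intervalIntegral.integral_const_mul, ← div_eq_inv_mul, div_le_iff₀ (by positivity)]
    exact (hlt n).le
  obtain ⟨w, φ, hφ, hw⟩ := h.exists_tendsto_subseq hB x hx1 hxΛ
  obtain ⟨F, hF⟩ := h.exists_isFlow hB w
  have hφtop := hφ.tendsto_atTop
  have hlim (t : ℝ) : Tendsto (fun n => D (y (φ n) t)) atTop (𝓝 (D (F t))) := by
    refine (D.continuous.tendsto _).comp (tendsto_iff_norm_sub_tendsto_zero.2 ?_)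
    have h1 (n : ℕ) : ‖(y (φ n) t : X) - F t‖ = ‖(x (φ n) : X) - w‖ := by
      have := (((hxy (φ n)).lift h).sub (hF.isSolution h)).norm_apply h hB t
      simpa only [A.map_sub, h.apply_lift] using this
    simp only [h1]
    exact tendsto_iff_norm_sub_tendsto_zero.1 hw
  -- in the limit, the observation of the solution issued from `B w` is constant on `[0, T]`
  have hconst (t : ℝ) (ht : t ∈ Icc 0 T) : D (F t) = D w := by
    have hDy (n : ℕ) : ‖D (y n t) - D (y n 0)‖ ^ 2 ≤ T * (1 / ((n : ℝ) + 1)) := by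
      have hder (s : ℝ) : HasDerivAt (fun s => D (y n s)) (Complex.I • C (y n s)) s := by
        refine ((D.restrictScalars ℝ).hasFDerivAt.comp_hasDerivAt s ((hxy n).2 s)).congr_deriv ?_
        rw [ContinuousLinearMap.coe_restrictScalars', map_smul, hD]
      have h1 := norm_sub_sq_le_integral hder
        (((hxy n).continuous_observation h hB hD).const_smul Complex.I) ht.1 ht.2
      simp only [norm_smul, Complex.norm_I, one_mul] at h1
      exact h1.trans (mul_le_mul_of_nonneg_left (hyint n) hT.le)
    have h0 : Tendsto (fun n => D (y (φ n) 0)) atTop (𝓝 (D w)) := by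
      have := hlim 0
      rwa [Complex.ofReal_zero, hF.init] at this
    have h2 : Tendsto (fun n : ℕ => T * (1 / ((n : ℝ) + 1))) atTop (𝓝 (T * 0)) :=
      tendsto_one_div_add_atTop_nhds_zero_nat.const_mul T
    have h3 := le_of_tendsto_of_tendsto' (((hlim t).sub h0).norm.pow 2) (h2.comp hφtop)
      fun n => hDy (φ n)
    rw [mul_zero] at h3
    exact sub_eq_zero.1 (norm_eq_zero.1 (pow_eq_zero_iff two_ne_zero |>.1
      (le_antisymm h3 (sq_nonneg _))))
  have hzero := hF.observation_eq_zero h.bound_pos hT hconst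
  have hwn : ‖w‖ = 1 :=
    tendsto_nhds_unique hw.norm (by simp only [hx1]; exact tendsto_const_nhds)
  have hlw : h.lift w ≠ 0 := by
    intro h0
    have : w = 0 := h.inv_eq_zero (by rw [← h.coe_lift, h0]; rfl)
    rw [this, norm_zero] at hwn
    exact zero_ne_one hwn
  -- a nonzero solution with vanishing observation contradicts the weak observation inequality
  obtain ⟨ε, ψ, hε, hψ, hscw⟩ := hsc
  have hE := hε.pos 0 le_rfl
  have hpi := Real.pi_pos
  have hl0 := h.frequency_nonneg (h.lift w)
  obtain ⟨S, hS⟩ := exists_isObservationTime (θ₀ := 4) (θ₁ := 2 * Real.pi * √(ε 0)) hε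
    (by norm_num) (by positivity) hl0
  have hSp := hS.1
  have hfin := hscw.weakObservationInequality h hB hD hε hψ hE le_rfl _ _ hlw (hF.isSolution h) S
    hS S le_rfl
  simp only [hD, h.apply_lift, hzero, norm_zero, ne_eq, OfNat.ofNat_ne_zero, not_false_eq_true,
    zero_pow, intervalIntegral.integral_zero] at hfin
  have hψp := hψ.pos (4 * (1 / S + frequency A (h.lift w))) (by positivity)
  have hnp := IsPositiveInverse.norm_pos hlw
  have : 0 < 2 * Real.pi * √(ε 0) / (4 * ε 0) * ψ (4 * (1 / S + frequency A (h.lift w)))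
      * ‖(h.lift w : X)‖ ^ 2 := by positivity
  exact absurd hfin (not_le.2 this)

theorem SpectrallyCoercive.weaklyObservableIn [CompleteSpace X] [CompleteSpace Y]
    (h : IsPositiveInverse A B m) (hB : IsCompactOperator B) (hD : ∀ z, C z = D (A z))
    (hsc : SpectrallyCoercive A C) {T : ℝ} (hT : 0 < T) : WeaklyObservableIn A C T := by
  choose δ hδ hobs using fun n : ℕ => hsc.exists_bound h hB hD hT ((n : ℝ) + 1)
  set d : ℕ → ℝ := fun n => (Finset.range (n + 1)).inf' Finset.nonempty_range_add_one δ with hd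
  obtain ⟨ψ, hψ, hψd⟩ := exists_profile_le_seq d
    (fun n => (Finset.lt_inf'_iff _).2 fun k _ => hδ k)
    (fun a b hab => Finset.inf'_mono _ (Finset.range_mono (by lia)) _)
  refine ⟨ψ, hψ, fun z₀ z hz0 hz => ?_⟩
  set l := frequency A z₀ with hl
  have h1 : ψ l ≤ δ ⌊l⌋₊ :=
    (hψd ⌊l⌋₊ l (Nat.floor_le (h.frequency_nonneg z₀))).trans
      (Finset.inf'_le _ (Finset.self_mem_range_succ _))
  exact (mul_le_mul_of_nonneg_right h1 (sq_nonneg _)).trans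
    (hobs ⌊l⌋₊ z₀ z hz0 (Nat.lt_floor_add_one l).le hz)

end Sufficiency

end WeakObservability

theorem theorem2p1 :
    -- The observation time `T(l)` exists, is unique, and is increasing in `l`.
    (∀ θ₀ θ₁ : ℝ, 0 < θ₀ → 0 < θ₁ → ∀ ε : ℝ → ℝ, WeakObservability.IsDecreasingProfile ε →
      (∀ l : ℝ, 0 ≤ l → ∃! T : ℝ, WeakObservability.IsObservationTime θ₀ θ₁ ε l T) ∧
      (∀ l l' T T' : ℝ, 0 ≤ l → l ≤ l' → WeakObservability.IsObservationTime θ₀ θ₁ ε l T →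
        WeakObservability.IsObservationTime θ₀ θ₁ ε l' T' → T ≤ T')) ∧
    -- The constants are fixed before the system; `θ₁, θ₂` know only an upper bound `E` of `ε`.
    (∃ θ₀ : ℝ, 0 < θ₀ ∧ ∀ E : ℝ, 0 < E → ∃ θ₁ θ₂ : ℝ, 0 < θ₁ ∧ 0 < θ₂ ∧
      ∀ (X : Type*) [NormedAddCommGroup X] [InnerProductSpace ℂ X] [CompleteSpace X]
        (Y : Type*) [NormedAddCommGroup Y] [InnerProductSpace ℂ Y] [CompleteSpace Y]
        (A : X →ₗ.[ℂ] X) (C : A.domain →ₗ[ℂ] Y),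
        IsSelfAdjoint A → WeakObservability.IsStrictlyPositive A →
        WeakObservability.HasCompactResolvent A →
        WeakObservability.IsBoundedOnDomain A C → WeakObservability.IsAdmissible A C →
        -- weak observability (in some time) iff spectral coercivity
        ((∃ T : ℝ, 0 < T ∧ WeakObservability.WeaklyObservableIn A C T) ↔
          WeakObservability.SpectrallyCoercive A C) ∧
        -- spectral coercivity iff the weak observation inequality, for some `ε, ψ`
        (WeakObservability.SpectrallyCoercive A C ↔
          ∃ ε ψ : ℝ → ℝ, WeakObservability.IsDecreasingProfile ε ∧
            WeakObservability.IsDecreasingProfile ψ ∧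
            WeakObservability.WeakObservationInequality A C θ₀ θ₁ θ₂ ε ψ) ∧
        -- the observation inequality holds with the functions of the spectral coercivity
        (∀ ε ψ : ℝ → ℝ, WeakObservability.IsDecreasingProfile ε →
          WeakObservability.IsDecreasingProfile ψ → ε 0 ≤ E →
          WeakObservability.SpectrallyCoerciveWith A C ε ψ →
          WeakObservability.WeakObservationInequality A C θ₀ θ₁ θ₂ ε ψ)) := by
  refine ⟨fun θ₀ θ₁ hθ₀ hθ₁ ε hε => ⟨fun l hl => ?_, fun l l' T T' hl hll' hT hT' =>
    WeakObservability.isObservationTime_mono hε hθ₀ hl hll' hT hT'⟩, 4, by norm_num, fun E hE =>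
    ⟨2 * Real.pi * √E, 2 * Real.pi * √E / (4 * E), ?_, ?_, ?_⟩⟩
  · obtain ⟨T, hT⟩ := WeakObservability.exists_isObservationTime hε hθ₀ hθ₁ hl
    exact ⟨T, hT, fun T' hT' => le_antisymm
      (WeakObservability.isObservationTime_mono hε hθ₀ hl le_rfl hT' hT)
      (WeakObservability.isObservationTime_mono hε hθ₀ hl le_rfl hT hT')⟩
  · have := Real.pi_pos
    positivity
  · have := Real.pi_pos
    positivity
  intro X _ _ _ Y _ _ _ A C hA hpos hres hC hadm
  obtain ⟨B, m, h, hB⟩ := WeakObservability.exists_isPositiveInverse hA hpos hres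
  obtain ⟨D, hD⟩ := h.exists_observation hC
  have hpi := Real.pi_pos
  refine ⟨⟨?_, ?_⟩, ⟨?_, ?_⟩, ?_⟩
  · rintro ⟨T, hT, hobs⟩
    exact hobs.spectrallyCoercive h hB hD hadm hT
  · exact fun hsc => ⟨1, one_pos, hsc.weaklyObservableIn h hB hD one_pos⟩
  · rintro ⟨ε, ψ, hε, hψ, hsc⟩
    -- coercivity is kept when `ε` is decreased to `min ε E`
    have hε' := hε.min (.const hE)
    refine ⟨_, ψ, hε', hψ, WeakObservability.SpectrallyCoerciveWith.weakObservationInequality h hB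
      hD hε' hψ (fun z hz hlt => hsc z hz (hlt.trans_le (min_le_left _ _))) hE (min_le_right _ _)⟩
  · rintro ⟨ε, ψ, hε, hψ, hobs⟩
    exact hobs.spectrallyCoercive h hB hD hadm (by norm_num) (by positivity) (by positivity) hε hψ
  · exact fun ε ψ hε hψ hεE hsc => hsc.weakObservationInequality h hB hD hε hψ hE hεE
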